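/- Let $M$ be a compact complex manifold of complex dimension $n$ (without boundary) with complex structure $J$, and let $\omega$ be a Kähler form on $M$, with Kähler metric $g=\omega(\cdot,J\cdot)$. Let $\mathcal M$ be the space of smooth Riemannian metrics on $M$, whose tangent space at each point is the space of smooth symmetric $(0,2)$-tensor fields, with the Ebin metric $$g_E(h,k)|_g=\int_M \operatorname{tr}(g^{-1}h\,g^{-1}k)\,dV_g .$$ For $\varphi\in C^\infty(M,\mathbb R)$ put $\omega_\varphi=\omega+\sqrt{-1}\,\partial\bar\partial\varphi$ and $g_\varphi=\omega_\varphi(\cdot,J\cdot)$, and let $\mathcal H_\omega=\{\varphi\in C^\infty(M,\mathbb R):\omega_\varphi>0\}$ and $\mathcal H=\{g_\varphi:\varphi\in\mathcal H_\omega\}\subset\mathcal M$. Let $\iota_{\mathcal H_\omega}:\mathcal H_\omega\to\mathcal M$, $\varphi\mapsto g_\varphi$, with differential $d\iota_{\mathcal H_\omega}|_\varphi(\nu)=\frac{d}{dt}\big|_{t=0}g_{\varphi+t\nu}$ for $\nu\in C^\infty(M,\mathbb R)$, and let $T_{g}\mathcal H$ consist of the tensors $d\iota_{\mathcal H_\omega}|_\varphi(\nu)$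 with $g_\varphi=g$ and $\nu\in C^\infty(M,\mathbb R)$. The Calabi metric is $$g_C(\nu,\eta)|_\varphi=\int_M \Delta_\varphi\nu\,\Delta_\varphi\eta\,\frac{\omega_\varphi^n}{n!},\qquad \Delta_\varphi f=g_\varphi^{i\bar\jmath}\,\frac{\partial^2 f}{\partial z^i\,\partial\overline{z^j}},$$ where $(g_\varphi)_{i\bar\jmath}=g_\varphi\big(\tfrac{\partial}{\partial z^i},\tfrac{\partial}{\partial\overline{z^j}}\big)$, so that $\omega_\varphi=\sqrt{-1}\,(g_\varphi)_{i\bar\jmath}\,dz^i\wedge d\overline{z^j}$. Then, for all $\varphi\in\mathcal H_\omega$ and $\nu,\eta\in C^\infty(M,\mathbb R)$, $$g_E\big(d\iota_{\mathcal H_\omega}|_\varphi(\nu),\,d\iota_{\mathcal H_\omega}|_\varphi(\eta)\big)\big|_{g_\varphi}=2\,g_C(\nu,\eta)|_\varphi ,$$ that is, $\iota_{\mathcal H_\omega}^\star g_E=2g_C$. Moreover $g_C$ descends along $\varphi\mapsto g_\varphi$ to a well-defined metric on $\mathcal H$, still denoted $g_C$, with $g_C\big(d\iota_{\mathcal H_\omega}|_\varphi(\nu),d\iota_{\mathcal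 H_\omega}|_\varphi(\eta)\big)\big|_{g_\varphi}=g_C(\nu,\eta)|_\varphi$, and for the inclusion $\iota_{\mathcal H}:\mathcal H\hookrightarrow\mathcal M$ one has $\iota_{\mathcal H}^\star g_E=2g_C$: for all $g\in\mathcal H$ and $h,k\in T_g\mathcal H$, $g_E(h,k)|_g=2\,g_C(h,k)|_g$. In other words, $(\mathcal H,2g_C)$ is isometrically embedded in $(\mathcal M,g_E)$. -/

import Mathlib

open scoped Manifold ContDiff Topology ComplexConjugate

namespace Kahler

/-- The model space `ℂⁿ`. -/
abbrev Cn (n : ℕ) : Type := Fin n → ℂ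

noncomputable section

/-- Multiplication by `i` on `ℂⁿ`, as a real linear map. -/
def mulI (n : ℕ) : Cn n →L[ℝ] Cn n := Complex.I • ContinuousLinearMap.id ℝ (Cn n)

/-- `∂F/∂zⁱ = (∂F/∂xⁱ - √-1 ∂F/∂yⁱ) / 2` on `ℂⁿ`. -/
def dz {n : ℕ} (i : Fin n) (F : Cn n → ℂ) (x : Cn n) : ℂ :=
  (1 / 2) * (fderiv ℝ F x (Pi.single i 1) - Complex.I * fderiv ℝ F x (Pi.single i Complex.I))

/-- `∂F/∂z̄ⁱ = (∂F/∂xⁱ + √-1 ∂F/∂yⁱ) / 2` on `ℂⁿ`. -/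
def dzbar {n : ℕ} (i : Fin n) (F : Cn n → ℂ) (x : Cn n) : ℂ :=
  (1 / 2) * (fderiv ℝ F x (Pi.single i 1) + Complex.I * fderiv ℝ F x (Pi.single i Complex.I))

/-- The complex Hessian `f_{i j̄} = ∂²f / ∂zⁱ ∂z̄ʲ` of a real function on `ℂⁿ`. -/
def cxHessian {n : ℕ} (f : Cn n → ℝ) (x : Cn n) : Matrix (Fin n) (Fin n) ℂ :=
  Matrix.of fun i j => dz i (dzbar j fun y => (f y : ℂ)) x

/-- The real `2`-form `√-1 a_{i j̄} dzⁱ ∧ dz̄ʲ` on `ℂⁿ`; its value on a pair of real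
tangent vectors is real when `a` is Hermitian. -/
def hermForm {n : ℕ} (a : Matrix (Fin n) (Fin n) ℂ) (u v : Cn n) : ℝ :=
  (Complex.I * ∑ i, ∑ j, a i j * (u i * conj (v j) - v i * conj (u j))).re

lemma isBilinearMap_hermForm {n : ℕ} (a : Matrix (Fin n) (Fin n) ℂ) :
    IsBilinearMap ℝ (hermForm a) where
  add_left u u' v := by
    simp only [hermForm, ← Complex.add_re, ← mul_add, ← Finset.sum_add_distrib]
    congr 2; refine Finset.sum_congr rfl fun i _ => Finset.sum_congr rfl fun j _ => ?_
    simp only [Pi.add_apply, map_add]; ring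
  smul_left c u v := by
    simp only [hermForm, smul_eq_mul, ← Complex.re_ofReal_mul, Finset.mul_sum]
    congr 1; refine Finset.sum_congr rfl fun i _ => Finset.sum_congr rfl fun j _ => ?_
    simp; ring
  add_right u v v' := by
    simp only [hermForm, ← Complex.add_re, ← mul_add, ← Finset.sum_add_distrib]
    congr 2; refine Finset.sum_congr rfl fun i _ => Finset.sum_congr rfl fun j _ => ?_
    simp only [Pi.add_apply, map_add]; ring
  smul_right c u v := by
    simp only [hermForm, smul_eq_mul, ← Complex.re_ofReal_mul, Finset.mul_sum]
    congr 1; refine Finset.sum_congr rfl fun i _ => Finset.sum_congr rfl fun j _ => ?_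
    simp; ring

/-- The real Hessian of `f` at `x`. -/
def realHessian {n : ℕ} (f : Cn n → ℝ) (x : Cn n) : Cn n →L[ℝ] Cn n →L[ℝ] ℝ :=
  fderiv ℝ (fderiv ℝ f) x

lemma cxHessian_apply {n : ℕ} {f : Cn n → ℝ} {x : Cn n} (hf : ContDiffAt ℝ 2 f x)
    (i j : Fin n) :
    let H := realHessian f x
    cxHessian f x i j = (1 / 4) *
      (((H (Pi.single i 1) (Pi.single j 1) +
        H (Pi.single i Complex.I) (Pi.single j Complex.I) : ℝ) : ℂ) +
        Complex.I * ((H (Pi.single i 1) (Pi.single j Complex.I) -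
          H (Pi.single i Complex.I) (Pi.single j 1) : ℝ) : ℂ)) := by
  intro H
  have h1 : ∀ᶠ y in 𝓝 x, ContDiffAt ℝ 2 f y := hf.eventually (by simp)
  have h2 : ∀ᶠ y in 𝓝 x, ∀ w, fderiv ℝ (fun y => (f y : ℂ)) y w = (fderiv ℝ f y w : ℂ) := by
    filter_upwards [h1] with y hy w
    have := (Complex.ofRealCLM.hasFDerivAt (x := f y)).comp y
      (hy.differentiableAt (by simp)).hasFDerivAt
    have h3 : HasFDerivAt (fun y => (f y : ℂ)) (Complex.ofRealCLM ∘L fderiv ℝ f y) y := this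
    rw [h3.fderiv]; rfl
  have h4 : (dzbar j fun y => (f y : ℂ)) =ᶠ[𝓝 x] fun y =>
      (1 / 2) * ((fderiv ℝ f y (Pi.single j 1) : ℂ) +
        Complex.I * (fderiv ℝ f y (Pi.single j Complex.I) : ℂ)) := by
    filter_upwards [h2] with y hy
    simp only [dzbar, hy]
  have hd : HasFDerivAt (fderiv ℝ f) H x :=
    ((hf.fderiv_right (m := 1) (by norm_num)).differentiableAt (by simp)).hasFDerivAt
  have h5 : ∀ w, HasFDerivAt (fun y => (fderiv ℝ f y w : ℂ))
      (Complex.ofRealCLM ∘L (H.flip w)) x := fun w =>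
    (Complex.ofRealCLM.hasFDerivAt).comp x
      ((ContinuousLinearMap.apply ℝ ℝ w).hasFDerivAt.comp x hd)
  have h6 := ((h5 (Pi.single j 1)).add ((h5 (Pi.single j Complex.I)).const_mul Complex.I)).const_mul
    (1 / 2 : ℂ)
  have h7 := h6.congr_of_eventuallyEq h4
  simp only [cxHessian, Matrix.of_apply, dz, h7.fderiv]
  simp
  ring_nf
  simp
  ring

lemma sesq_expand {n : ℕ} (S : Cn n → Cn n → ℂ)
    (al : ∀ u u' v, S (u + u') v = S u v + S u' v) (ar : ∀ u v v', S u (v + v') = S u v + S u v')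
    (sl : ∀ (c : ℂ) u v, S (c • u) v = c * S u v)
    (sr : ∀ (c : ℂ) u v, S u (c • v) = conj c * S u v) (u v : Cn n) :
    S u v = ∑ i, ∑ j, S (Pi.single i 1) (Pi.single j 1) * (u i * conj (v j)) := by
  let L : Cn n →ₗ[ℂ] Cn n →ₛₗ[starRingEnd ℂ] ℂ := LinearMap.mk₂'ₛₗ _ _ S al
    (fun c u v => sl c u v) ar (fun c u v => sr c u v)
  change L u v = _
  conv_lhs => rw [pi_eq_sum_univ' u, pi_eq_sum_univ' v]
  simp only [map_sum, LinearMap.sum_apply, map_smul, LinearMap.smul_apply, smul_eq_mul,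
    LinearMap.map_smulₛₗ]
  rw [Finset.sum_comm]
  refine Finset.sum_congr rfl fun i _ => ?_
  rw [Finset.mul_sum]
  refine Finset.sum_congr rfl fun j _ => ?_
  change _ = L _ _ * _
  ring

/-- `√-1 ∂∂̄ f` in terms of the real Hessian. -/
lemma hermForm_cxHessian {n : ℕ} {f : Cn n → ℝ} {x : Cn n} (hf : ContDiffAt ℝ 2 f x)
    (u v : Cn n) :
    hermForm (cxHessian f x) u v =
      (realHessian f x (mulI n u) v - realHessian f x u (mulI n v)) / 2 := by
  set H := realHessian f x with hH
  have hsymm : ∀ a b, H a b = H b a := fun a b =>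
    (hf.isSymmSndFDerivAt (by simp)) a b
  have hI : ∀ w : Cn n, mulI n (mulI n w) = -w := fun w => by
    ext i; simp [mulI, ← mul_assoc]
  have hc : ∀ (c : ℂ) (w : Cn n), c • w = c.re • w + c.im • mulI n w := fun c w => by
    ext i
    simp only [mulI, Pi.smul_apply, Pi.add_apply, smul_apply,
      ContinuousLinearMap.id_apply, smul_eq_mul, Complex.real_smul]
    conv_lhs => rw [← Complex.re_add_im c]
    ring
  have hc' : ∀ (c : ℂ) (w : Cn n), mulI n (c • w) = c.re • mulI n w + c.im • (-w) := fun c w => by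
    rw [hc, map_add, map_smul, map_smul, hI]
  let S : Cn n → Cn n → ℂ := fun u v => (1 / 4) *
    (((H u v + H (mulI n u) (mulI n v) : ℝ) : ℂ) +
      Complex.I * ((H u (mulI n v) - H (mulI n u) v : ℝ) : ℂ))
  have hS := sesq_expand S
    (by intro u u' v; simp only [S, map_add, add_apply]; push_cast; ring)
    (by intro u v v'; simp only [S, map_add]; push_cast; ring)
    (by
      intro c u v
      simp only [S, hc, map_add, map_smul, map_neg, hI, add_apply,
        smul_apply, neg_apply, smul_eq_mul]
      apply Complex.ext <;> simp <;> ring)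
    (by
      intro c u v
      simp only [S, hc, map_add, map_smul, map_neg, hI, smul_eq_mul]
      apply Complex.ext <;> simp <;> ring)
  have he : ∀ i : Fin n, mulI n (Pi.single i 1) = Pi.single i Complex.I := fun i => by
    ext j; by_cases h : j = i
    · subst h; simp [mulI]
    · simp [mulI, h]
  have hM : ∀ i j, cxHessian f x i j = S (Pi.single i 1) (Pi.single j 1) := fun i j => by
    rw [cxHessian_apply hf]; simp only [S, he, hH]
  have h1 : hermForm (cxHessian f x) u v = (Complex.I * (S u v - S v u)).re := by
    rw [hS u v, hS v u, ← Finset.sum_sub_distrib, hermForm]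
    simp only [← Finset.sum_sub_distrib, hM, mul_sub]
  rw [h1]
  simp [S, hsymm v u, hsymm (mulI n v), hsymm v (mulI n u)]
  ring

lemma realHessian_comp {n : ℕ} {f : Cn n → ℝ} {T : Cn n → Cn n} {x : Cn n}
    (hT : ContDiffAt ℝ 2 T x) (hf : ContDiffAt ℝ 2 f (T x)) (u v : Cn n) :
    realHessian (f ∘ T) x u v =
      realHessian f (T x) (fderiv ℝ T x u) (fderiv ℝ T x v) +
        fderiv ℝ f (T x) (fderiv ℝ (fderiv ℝ T) x u v) := by
  have h1 : fderiv ℝ (f ∘ T) =ᶠ[𝓝 x] fun y => (fderiv ℝ f (T y)).comp (fderiv ℝ T y) := by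
    filter_upwards [hT.eventually (by simp), hT.continuousAt.eventually (hf.eventually (by simp))]
      with y hy hy'
    exact fderiv_comp y (hy'.differentiableAt (by simp)) (hy.differentiableAt (by simp))
  have hd : HasFDerivAt (fderiv ℝ f) (realHessian f (T x)) (T x) :=
    ((hf.fderiv_right (m := 1) (by norm_num)).differentiableAt (by simp)).hasFDerivAt
  have hd' : HasFDerivAt (fderiv ℝ T) (fderiv ℝ (fderiv ℝ T) x) x :=
    ((hT.fderiv_right (m := 1) (by norm_num)).differentiableAt (by simp)).hasFDerivAt
  have h2 := (hd.comp x (hT.differentiableAt (by simp)).hasFDerivAt).clm_comp hd'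
  have h3 := h2.congr_of_eventuallyEq h1
  rw [realHessian, h3.fderiv]
  simp
  ring

/-- The complex Hessian form transforms as a tensor under holomorphic maps. -/
lemma hermForm_cxHessian_comp {n : ℕ} {f : Cn n → ℝ} {T : Cn n → Cn n} {x : Cn n}
    (hT : ContDiffAt ℂ 2 T x) (hf : ContDiffAt ℝ 2 f (T x)) (u v : Cn n) :
    hermForm (cxHessian (f ∘ T) x) u v =
      hermForm (cxHessian f (T x)) (fderiv ℝ T x u) (fderiv ℝ T x v) := by
  have hTr : ContDiffAt ℝ 2 T x := hT.restrict_scalars ℝ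
  have hI : ∀ᶠ y in 𝓝 x, ∀ w, fderiv ℝ T y (mulI n w) = mulI n (fderiv ℝ T y w) := by
    filter_upwards [hT.eventually (by simp)] with y hy w
    have h := (hy.differentiableAt (by simp)).fderiv_restrictScalars ℝ
    rw [h]
    simp [mulI]
  have hd' : HasFDerivAt (fderiv ℝ T) (fderiv ℝ (fderiv ℝ T) x) x :=
    ((hTr.fderiv_right (m := 1) (by norm_num)).differentiableAt (by simp)).hasFDerivAt
  have h2 : ∀ u w, fderiv ℝ (fderiv ℝ T) x u (mulI n w) =
      mulI n (fderiv ℝ (fderiv ℝ T) x u w) := by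
    intro u w
    have e1 : HasFDerivAt (fun y => fderiv ℝ T y (mulI n w))
        ((fderiv ℝ (fderiv ℝ T) x).flip (mulI n w)) x :=
      (ContinuousLinearMap.apply ℝ (Cn n) (mulI n w)).hasFDerivAt.comp x hd'
    have e2 : HasFDerivAt (fun y => mulI n (fderiv ℝ T y w))
        (mulI n ∘L ((fderiv ℝ (fderiv ℝ T) x).flip w)) x :=
      (mulI n).hasFDerivAt.comp x
        ((ContinuousLinearMap.apply ℝ (Cn n) w).hasFDerivAt.comp x hd')
    have e3 := e1.congr_of_eventuallyEq (f₁ := fun y => mulI n (fderiv ℝ T y w))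
      (by filter_upwards [hI] with y hy using (hy w).symm)
    exact congrArg (fun L => L u) (e3.unique e2)
  have hs : ∀ u w, fderiv ℝ (fderiv ℝ T) x u w = fderiv ℝ (fderiv ℝ T) x w u := fun a b =>
    (hTr.isSymmSndFDerivAt (by simp)) a b
  rw [hermForm_cxHessian (ContDiffAt.comp x hf hTr), hermForm_cxHessian hf,
    realHessian_comp hTr hf, realHessian_comp hTr hf, hI.self_of_nhds, hI.self_of_nhds, h2,
    hs (mulI n u), h2, hs v u]
  ring


section Manifold

variable (n : ℕ) {M : Type*} [TopologicalSpace M] [ChartedSpace (Cn n) M]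

/-- A complex manifold is a smooth real manifold, with the same charts. -/
instance realIsManifold [IsManifold 𝓘(ℂ, Cn n) ω M] : IsManifold 𝓘(ℝ, Cn n) ∞ M := by
  apply isManifold_of_contDiffOn
  intro e e' he he'
  have h : ContDiffOn ℂ ω _ _ :=
    (HasGroupoid.compatible (G := contDiffGroupoid ω 𝓘(ℂ, Cn n)) he he').1
  exact (h.restrict_scalars ℝ).of_le le_top

/-- The real tangent space of `M` at `p`. In Mathlib it is the model space `ℂⁿ`, a tangent vector
being given by its components in the preferred chart at `p`. -/
abbrev Tan (p : M) : Type := TangentSpace 𝓘(ℝ, Cn n) p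

/-- The complex structure `J` of `M`: multiplication by `i` in a holomorphic chart. -/
def cxJ (p : M) : Tan n p →L[ℝ] Tan n p := mulI n

/-- The value at `p` of the real `2`-form `√-1 ∂∂̄ f`, computed in the preferred holomorphic
chart at `p`. -/
def iddbar (f : M → ℝ) (p : M) : Tan n p →L[ℝ] Tan n p →L[ℝ] ℝ :=
  (isBilinearMap_hermForm (cxHessian (f ∘ (chartAt (Cn n) p).symm)
    (chartAt (Cn n) p p))).toContinuousBilinearMap

variable {n}

lemma contDiffAt_chart [IsManifold 𝓘(ℂ, Cn n) ω M] {f : M → ℝ}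
    (hf : ContMDiff 𝓘(ℝ, Cn n) 𝓘(ℝ) ∞ f) (c : M) {x : Cn n}
    (hx : x ∈ (chartAt (Cn n) c).target) :
    ContDiffAt ℝ ∞ (f ∘ (chartAt (Cn n) c).symm) x := by
  have h := contMDiffOn_chart_symm (I := 𝓘(ℝ, Cn n)) (n := ∞) (x := c)
  have h1 := (hf.comp_contMDiffOn h).contMDiffAt ((chartAt (Cn n) c).open_target.mem_nhds hx)
  exact contMDiffAt_iff_contDiffAt.1 h1

lemma contDiffAt_chart_two [IsManifold 𝓘(ℂ, Cn n) ω M] {f : M → ℝ}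
    (hf : ContMDiff 𝓘(ℝ, Cn n) 𝓘(ℝ) ∞ f) (c : M) {x : Cn n}
    (hx : x ∈ (chartAt (Cn n) c).target) :
    ContDiffAt ℝ 2 (f ∘ (chartAt (Cn n) c).symm) x :=
  (contDiffAt_chart hf c hx).of_le ENat.LEInfty.out

lemma iddbar_apply [IsManifold 𝓘(ℂ, Cn n) ω M] {f : M → ℝ}
    (hf : ContMDiff 𝓘(ℝ, Cn n) 𝓘(ℝ) ∞ f) (p : M) (u v : Tan n p) :
    iddbar n f p u v =
      (realHessian (f ∘ (chartAt (Cn n) p).symm) (chartAt (Cn n) p p) (mulI n u) v -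
        realHessian (f ∘ (chartAt (Cn n) p).symm) (chartAt (Cn n) p p) u (mulI n v)) / 2 :=
  hermForm_cxHessian (contDiffAt_chart_two hf p (mem_chart_target _ p)) u v

lemma mulI_mulI (w : Cn n) : mulI n (mulI n w) = -w := by
  ext i; simp [mulI, ← mul_assoc]

lemma iddbar_cxJ [IsManifold 𝓘(ℂ, Cn n) ω M] {f : M → ℝ}
    (hf : ContMDiff 𝓘(ℝ, Cn n) 𝓘(ℝ) ∞ f) (p : M) (u v : Tan n p) :
    iddbar n f p u (cxJ n p v) =
      (realHessian (f ∘ (chartAt (Cn n) p).symm) (chartAt (Cn n) p p) (mulI n u) (mulI n v) +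
        realHessian (f ∘ (chartAt (Cn n) p).symm) (chartAt (Cn n) p p) u v) / 2 := by
  have h : ∀ (H : Cn n →L[ℝ] Cn n →L[ℝ] ℝ) (a b : Cn n),
      (H (mulI n a) (mulI n b) - H a (mulI n (mulI n b))) / 2 =
        (H (mulI n a) (mulI n b) + H a b) / 2 := fun H a b => by rw [mulI_mulI]; simp
  exact (iddbar_apply hf p u (cxJ n p v)).trans (h _ u v)

lemma iddbar_cxJ_symm [IsManifold 𝓘(ℂ, Cn n) ω M] {f : M → ℝ}
    (hf : ContMDiff 𝓘(ℝ, Cn n) 𝓘(ℝ) ∞ f) (p : M) (u v : Tan n p) :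
    iddbar n f p u (cxJ n p v) = iddbar n f p v (cxJ n p u) := by
  have hsymm := (contDiffAt_chart_two hf p (mem_chart_target _ p)).isSymmSndFDerivAt (by simp)
  have h : ∀ a b, realHessian (f ∘ (chartAt (Cn n) p).symm) (chartAt (Cn n) p p) a b =
    realHessian (f ∘ (chartAt (Cn n) p).symm) (chartAt (Cn n) p p) b a := fun a b => hsymm a b
  have h' : ∀ a b : Cn n, iddbar n f p a (cxJ n p b) = iddbar n f p b (cxJ n p a) := fun a b => by
    refine (iddbar_cxJ hf p a b).trans (Eq.trans ?_ (iddbar_cxJ hf p b a).symm)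
    rw [h (mulI n a), h a]
  exact h' u v

lemma iddbar_add_smul [IsManifold 𝓘(ℂ, Cn n) ω M] {f g : M → ℝ}
    (hf : ContMDiff 𝓘(ℝ, Cn n) 𝓘(ℝ) ∞ f) (hg : ContMDiff 𝓘(ℝ, Cn n) 𝓘(ℝ) ∞ g) (t : ℝ) (p : M) :
    iddbar n (f + t • g) p = iddbar n f p + t • iddbar n g p := by
  have hfg : ContMDiff 𝓘(ℝ, Cn n) 𝓘(ℝ) ∞ (f + t • g) := by
    let f' : C^∞⟮𝓘(ℝ, Cn n), M; 𝓘(ℝ), ℝ⟯ := ⟨f, hf⟩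
    let g' : C^∞⟮𝓘(ℝ, Cn n), M; 𝓘(ℝ), ℝ⟯ := ⟨g, hg⟩
    exact (f' + t • g').contMDiff
  have e1 := fun {x : Cn n} (hx : x ∈ (chartAt (Cn n) p).target) => contDiffAt_chart_two hf p hx
  have e2 := fun {x : Cn n} (hx : x ∈ (chartAt (Cn n) p).target) => contDiffAt_chart_two hg p hx
  have ht := mem_chart_target (Cn n) p
  set F := f ∘ (chartAt (Cn n) p).symm with hF
  set G := g ∘ (chartAt (Cn n) p).symm with hG
  have key : realHessian ((f + t • g) ∘ (chartAt (Cn n) p).symm) (chartAt (Cn n) p p) =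
      realHessian F (chartAt (Cn n) p p) + t • realHessian G (chartAt (Cn n) p p) := by
    have h1 : fderiv ℝ ((f + t • g) ∘ (chartAt (Cn n) p).symm) =ᶠ[𝓝 (chartAt (Cn n) p p)]
        fun y => fderiv ℝ F y + t • fderiv ℝ G y := by
      filter_upwards [(chartAt (Cn n) p).open_target.mem_nhds ht] with y hy
      exact (((e1 hy).differentiableAt (by simp)).hasFDerivAt.add
        (((e2 hy).differentiableAt (by simp)).hasFDerivAt.const_smul t)).fderiv
    have d1 := (((e1 ht).fderiv_right (m := 1) (by norm_num)).differentiableAt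
      (by simp)).hasFDerivAt
    have d2 := (((e2 ht).fderiv_right (m := 1) (by norm_num)).differentiableAt
      (by simp)).hasFDerivAt
    exact ((d1.add (d2.const_smul t)).congr_of_eventuallyEq h1).fderiv
  ext u v
  change _ = iddbar n f p u v + t * iddbar n g p u v
  have h : ∀ (A B : Cn n →L[ℝ] Cn n →L[ℝ] ℝ) (a b : Cn n),
      ((A + t • B) (mulI n a) b - (A + t • B) a (mulI n b)) / 2 =
        (A (mulI n a) b - A a (mulI n b)) / 2 + t * ((B (mulI n a) b - B a (mulI n b)) / 2) := by
    intro A B a b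
    simp only [add_apply, smul_apply, smul_eq_mul]
    ring
  rw [iddbar_apply hf, iddbar_apply hg, iddbar_apply hfg, key]
  exact h _ _ u v

variable [IsManifold 𝓘(ℂ, Cn n) ω M]

variable (n) in
/-- The tangent vector at `p` with components `v` in the coordinates of the preferred chart
at `c`, for `p` in the domain of that chart. -/
def coordVec (c p : M) : Cn n →L[ℝ] Tan n p := tangentCoordChange 𝓘(ℝ, Cn n) c p p

lemma coordVec_eq (c p : M) : coordVec n c p =
    fderiv ℝ (chartAt (Cn n) p ∘ (chartAt (Cn n) c).symm) (chartAt (Cn n) c p) := by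
  rw [← fderivWithin_univ]
  change fderivWithin _ _ (Set.range id) _ = _
  rw [Set.range_id]
  rfl

lemma contDiffAt_transition {c p : M} (hp : p ∈ (chartAt (Cn n) c).source) :
    ContDiffAt ℂ 2 (chartAt (Cn n) p ∘ (chartAt (Cn n) c).symm) (chartAt (Cn n) c p) := by
  have h : ContDiffOn ℂ ω _ _ := (HasGroupoid.compatible (G := contDiffGroupoid ω 𝓘(ℂ, Cn n))
      (chart_mem_atlas (Cn n) c) (chart_mem_atlas (Cn n) p)).1
  have h1 : ContDiffOn ℂ ω (chartAt (Cn n) p ∘ (chartAt (Cn n) c).symm)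
      ((chartAt (Cn n) c).symm ≫ₕ chartAt (Cn n) p).source := by
    simpa using! h
  refine (h1.contDiffAt (((chartAt (Cn n) c).symm ≫ₕ chartAt (Cn n) p).open_source.mem_nhds ?_)).of_le
    le_top
  simp [hp]

lemma coordVec_mulI {c p : M} (hp : p ∈ (chartAt (Cn n) c).source) (v : Cn n) :
    coordVec n c p (mulI n v) = cxJ n p (coordVec n c p v) := by
  rw [coordVec_eq, ((contDiffAt_transition hp).differentiableAt
    (by simp)).fderiv_restrictScalars ℝ]
  exact map_smul (fderiv ℂ (chartAt (Cn n) p ∘ (chartAt (Cn n) c).symm) (chartAt (Cn n) c p))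
    Complex.I v

lemma iddbar_coordVec {f : M → ℝ} (hf : ContMDiff 𝓘(ℝ, Cn n) 𝓘(ℝ) ∞ f) {c p : M}
    (hp : p ∈ (chartAt (Cn n) c).source) (u v : Cn n) :
    iddbar n f p (coordVec n c p u) (coordVec n c p v) =
      hermForm (cxHessian (f ∘ (chartAt (Cn n) c).symm) (chartAt (Cn n) c p)) u v := by
  set T := chartAt (Cn n) p ∘ (chartAt (Cn n) c).symm with hT
  set x := chartAt (Cn n) c p with hx
  have hTx : T x = chartAt (Cn n) p p := by simp [hT, hx, hp]
  have hTc := contDiffAt_transition hp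
  have hxt : x ∈ (chartAt (Cn n) c).target := (chartAt (Cn n) c).map_source hp
  have hfp : ContDiffAt ℝ 2 (f ∘ (chartAt (Cn n) p).symm) (T x) := by
    rw [hTx]; exact contDiffAt_chart_two hf p (mem_chart_target _ p)
  have h1 := hermForm_cxHessian_comp hTc hfp u v
  have h2 : (f ∘ (chartAt (Cn n) p).symm) ∘ T =ᶠ[𝓝 x] f ∘ (chartAt (Cn n) c).symm := by
    have : ((chartAt (Cn n) c).symm ≫ₕ chartAt (Cn n) p).source ∈ 𝓝 x :=
      ((chartAt (Cn n) c).symm ≫ₕ chartAt (Cn n) p).open_source.mem_nhds (by simp [hx, hp])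
    filter_upwards [this] with y hy
    simp at hy
    simp [hT, hy.2]
  have h3 : realHessian ((f ∘ (chartAt (Cn n) p).symm) ∘ T) x =
    realHessian (f ∘ (chartAt (Cn n) c).symm) x := (h2.fderiv).fderiv_eq
  rw [hermForm_cxHessian (ContDiffAt.comp x hfp (hTc.restrict_scalars ℝ)), h3,
    ← hermForm_cxHessian (contDiffAt_chart_two hf c hxt)] at h1
  rw [h1, coordVec_eq]
  change hermForm (cxHessian _ _) _ _ = hermForm (cxHessian _ (T x)) _ _
  rw [hTx]
  rfl

/-- Smoothness of a field of bilinear forms, from smoothness of its components in charts. -/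
lemma contMDiff_of_coord (h : ∀ p : M, Tan n p →L[ℝ] Tan n p →L[ℝ] ℝ)
    (H : ∀ c : M, ∃ K : Cn n → (Cn n →L[ℝ] Cn n →L[ℝ] ℝ),
      ContDiffOn ℝ ∞ K (chartAt (Cn n) c).target ∧
      ∀ p ∈ (chartAt (Cn n) c).source, ∀ u v,
        h p (coordVec n c p u) (coordVec n c p v) = K (chartAt (Cn n) c p) u v) :
    ContMDiff 𝓘(ℝ, Cn n) (𝓘(ℝ, Cn n).prod 𝓘(ℝ, Cn n →L[ℝ] Cn n →L[ℝ] ℝ)) ∞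
    (fun p => Bundle.TotalSpace.mk' (Cn n →L[ℝ] Cn n →L[ℝ] ℝ)
      (E := fun p : M => Tan n p →L[ℝ] Tan n p →L[ℝ] ℝ) p (h p)) := by
  intro c
  obtain ⟨K, hK, hh⟩ := H c
  rw [contMDiffAt_hom_bundle]
  refine ⟨contMDiffAt_id, ?_⟩
  have h1 : ContMDiffAt 𝓘(ℝ, Cn n) 𝓘(ℝ, Cn n →L[ℝ] Cn n →L[ℝ] ℝ) ∞
      (fun p => K (chartAt (Cn n) c p)) c := by
    have a := (hK.contDiffAt ((chartAt (Cn n) c).open_target.mem_nhds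
      (mem_chart_target _ c))).contMDiffAt
    exact a.comp c (contMDiffAt_of_mem_maximalAtlas
      (IsManifold.chart_mem_maximalAtlas c) (mem_chart_source _ c))
  refine h1.congr_of_eventuallyEq ?_
  filter_upwards [(chartAt (Cn n) c).open_source.mem_nhds (mem_chart_source _ c)] with p hp
  ext1 u
  ext1 v
  rw [← hh p hp]
  have hb : p ∈ (trivializationAt (Cn n) (TangentSpace 𝓘(ℝ, Cn n)) c).baseSet := hp
  have e := inCoordinates_apply_eq₂ (𝕜 := ℝ) (F₁ := Cn n) (F₂ := Cn n)
    (F₃ := ℝ) (E₁ := fun p : M => Tan n p) (E₂ := fun p : M => Tan n p) (E₃ := fun _ : M => ℝ)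
    (x₀ := c) (x := p) (ϕ := h p) (v := u) (w := v) hb hb (by simp)
  refine e.trans ?_
  have hs := TangentBundle.symmL_trivializationAt_eq_core (I := 𝓘(ℝ, Cn n)) hp
  have hs' : ∀ w, (trivializationAt (Cn n) (TangentSpace 𝓘(ℝ, Cn n)) c).symm p w =
      coordVec n c p w := fun w => by
    rw [← Bundle.Trivialization.symmL_apply (R := ℝ) _ hb, hs]; rfl
  rw [hs', hs']
  simp

lemma contMDiff_iddbar_cxJ {f : M → ℝ} (hf : ContMDiff 𝓘(ℝ, Cn n) 𝓘(ℝ) ∞ f) :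
    ContMDiff 𝓘(ℝ, Cn n) (𝓘(ℝ, Cn n).prod 𝓘(ℝ, Cn n →L[ℝ] Cn n →L[ℝ] ℝ)) ∞
    (fun p => Bundle.TotalSpace.mk' (Cn n →L[ℝ] Cn n →L[ℝ] ℝ)
      (E := fun p : M => Tan n p →L[ℝ] Tan n p →L[ℝ] ℝ) p
        ((ContinuousLinearMap.precomp ℝ (cxJ n p)).comp (iddbar n f p))) := by
  apply contMDiff_of_coord
  intro c
  set F := f ∘ (chartAt (Cn n) c).symm with hF
  refine ⟨fun x => (1 / 2 : ℝ) • ((realHessian F x).bilinearComp (mulI n) (mulI n) +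
    realHessian F x), ?_, ?_⟩
  · have h2 : ContDiffOn ℝ ∞ (realHessian F) (chartAt (Cn n) c).target := fun x hx =>
      (((contDiffAt_chart hf c hx).fderiv_right (m := ∞) (by simp)).fderiv_right
        (m := ∞) (by simp)).contDiffWithinAt
    refine contDiffOn_clm_apply.2 fun u => contDiffOn_clm_apply.2 fun v => ?_
    have h3 : ∀ a b : Cn n, ContDiffOn ℝ ∞ (fun x => realHessian F x a b)
      (chartAt (Cn n) c).target := fun a b =>
      contDiffOn_clm_apply.1 (contDiffOn_clm_apply.1 h2 a) b
    exact contDiffOn_const.mul ((h3 (mulI n u) (mulI n v)).add (h3 u v))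
  · intro p hp u v
    have hx := (chartAt (Cn n) c).map_source hp
    change iddbar n f p (coordVec n c p u) (cxJ n p (coordVec n c p v)) = _
    rw [← coordVec_mulI hp, iddbar_coordVec hf hp,
      hermForm_cxHessian (contDiffAt_chart_two hf c hx), mulI_mulI]
    simp [hF]
    ring

end Manifold

section Metrics

variable (n : ℕ) (M : Type*) [TopologicalSpace M] [ChartedSpace (Cn n) M]
  [IsManifold 𝓘(ℂ, Cn n) ω M]

/-- The space `𝓜` of smooth Riemannian metrics on `M`. -/
abbrev RiemMetric : Type _ :=
  Bundle.ContMDiffRiemannianMetric 𝓘(ℝ, Cn n) ∞ (Cn n) (fun p : M => Tan n p)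

/-- The space of smooth symmetric `(0,2)`-tensor fields on `M`, which is the tangent space of `𝓜`
at each of its points. -/
@[ext] structure SymTensor where
  toFun (p : M) : Tan n p →L[ℝ] Tan n p →L[ℝ] ℝ
  symm (p : M) (u v : Tan n p) : toFun p u v = toFun p v u
  contMDiff : ContMDiff 𝓘(ℝ, Cn n) (𝓘(ℝ, Cn n).prod 𝓘(ℝ, Cn n →L[ℝ] Cn n →L[ℝ] ℝ)) ∞
    (fun p => Bundle.TotalSpace.mk' (Cn n →L[ℝ] Cn n →L[ℝ] ℝ)
      (E := fun p : M => Tan n p →L[ℝ] Tan n p →L[ℝ] ℝ) p (toFun p))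

/-- The space of smooth real functions on `M`. -/
abbrev Smooth : Type _ := C^∞⟮𝓘(ℝ, Cn n), M; 𝓘(ℝ), ℝ⟯

variable {n M}

/-- The component of a field of bilinear forms `β` on the components `v`, `w`, as a function of the
coordinates in the preferred chart at `c`. -/
def coordForm (β : ∀ p : M, Tan n p →L[ℝ] Tan n p →L[ℝ] ℝ) (c : M) (v w : Cn n) (x : Cn n) : ℝ :=
  let p := (chartAt (Cn n) c).symm x
  β p (coordVec n c p v) (coordVec n c p w)

/-- `dβ = 0` for a field `β` of alternating bilinear forms, in local coordinates:
`dβ(u,v,w) = ∂_u β(v,w) + ∂_v β(w,u) + ∂_w β(u,v)` for constant vector fields `u`, `v`, `w`. -/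
def IsClosedForm (β : ∀ p : M, Tan n p →L[ℝ] Tan n p →L[ℝ] ℝ) : Prop :=
  ∀ c : M, ∀ x ∈ (chartAt (Cn n) c).target, ∀ u v w : Cn n,
    fderiv ℝ (coordForm β c v w) x u + fderiv ℝ (coordForm β c w u) x v +
      fderiv ℝ (coordForm β c u v) x w = 0

variable (n M) in
/-- A Kähler structure on the complex manifold `M`: a Hermitian Riemannian metric `g` whose
Kähler form `ω = g(J·,·)` is closed. -/
structure KahlerStructure where
  metric : RiemMetric n M
  hermitian (p : M) (u v : Tan n p) :
    metric.inner p (cxJ n p u) (cxJ n p v) = metric.inner p u v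
  closed : IsClosedForm fun p => (metric.inner p).comp (cxJ n p)

/-- The Kähler form `ω`, related to the metric by `g(·,·) = ω(·,J·)`. -/
def KahlerStructure.form (K : KahlerStructure n M) (p : M) : Tan n p →L[ℝ] Tan n p →L[ℝ] ℝ :=
  (K.metric.inner p).comp (cxJ n p)

/-- `ω_φ = ω + √-1 ∂∂̄ φ`. -/
def kahlerForm (K : KahlerStructure n M) (φ : Smooth n M) (p : M) :
    Tan n p →L[ℝ] Tan n p →L[ℝ] ℝ :=
  K.form p + iddbar n φ p

/-- `g_φ(·,·) = ω_φ(·,J·)`. -/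
def metricTensor (K : KahlerStructure n M) (φ : Smooth n M) (p : M) :
    Tan n p →L[ℝ] Tan n p →L[ℝ] ℝ :=
  (ContinuousLinearMap.precomp ℝ (cxJ n p)).comp (kahlerForm K φ p)

@[simp] lemma metricTensor_apply (K : KahlerStructure n M) (φ : Smooth n M) (p : M)
    (u v : Tan n p) : metricTensor K φ p u v = kahlerForm K φ p u (cxJ n p v) := rfl

/-- The space `𝓗_ω` of Kähler potentials: smooth functions `φ` with `ω_φ > 0`. -/
def kahlerPotentials (K : KahlerStructure n M) : Set (Smooth n M) :=
  {φ | ∀ (p : M) (v : Tan n p), v ≠ 0 → 0 < kahlerForm K φ p v (cxJ n p v)}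

lemma metricTensor_eq (K : KahlerStructure n M) (φ : Smooth n M) (p : M) :
    metricTensor K φ p = K.metric.inner p +
      (ContinuousLinearMap.precomp ℝ (cxJ n p)).comp (iddbar n φ p) := by
  ext u v
  change K.metric.inner p (cxJ n p u) (cxJ n p v) + iddbar n φ p u (cxJ n p v) = _
  rw [K.hermitian]
  rfl

lemma metricTensor_symm (K : KahlerStructure n M) (φ : Smooth n M) (p : M) (u v : Tan n p) :
    metricTensor K φ p u v = metricTensor K φ p v u := by
  rw [metricTensor_eq]
  change K.metric.inner p u v + iddbar n φ p u (cxJ n p v) =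
    K.metric.inner p v u + iddbar n φ p v (cxJ n p u)
  rw [K.metric.symm, iddbar_cxJ_symm φ.contMDiff]

lemma metricTensor_add_smul (K : KahlerStructure n M) (φ ν : Smooth n M) (t : ℝ) (p : M) :
    metricTensor K (φ + t • ν) p = metricTensor K φ p +
      t • (ContinuousLinearMap.precomp ℝ (cxJ n p)).comp (iddbar n ν p) := by
  have h : iddbar n (⇑(φ + t • ν)) p = iddbar n φ p + t • iddbar n ν p :=
    iddbar_add_smul φ.contMDiff ν.contMDiff t p
  rw [metricTensor_eq, metricTensor_eq, h]
  ext u v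
  simp only [add_apply, ContinuousLinearMap.comp_apply, smul_apply, map_add, map_smul]
  exact (add_assoc _ _ _).symm

lemma isVonNBounded_of_pos (B : Cn n →L[ℝ] Cn n →L[ℝ] ℝ) (hB : ∀ v, v ≠ 0 → 0 < B v v) :
    Bornology.IsVonNBounded ℝ {v : Cn n | B v v < 1} := by
  rw [NormedSpace.isVonNBounded_iff']
  have hcont : Continuous fun v : Cn n => B v v := by fun_prop
  rcases (Metric.sphere (0 : Cn n) 1).eq_empty_or_nonempty with h | h
  · refine ⟨0, fun x _ => ?_⟩
    by_contra hx
    push Not at hx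
    have : (‖x‖⁻¹ • x) ∈ Metric.sphere (0 : Cn n) 1 := by
      simp [norm_smul, hx.ne']
    simp [h] at this
  · obtain ⟨w, hw, hmin⟩ := (isCompact_sphere (0 : Cn n) 1).exists_isMinOn h hcont.continuousOn
    have hw0 : w ≠ 0 := by rintro rfl; simp at hw
    have hm := hB w hw0
    refine ⟨(B w w)⁻¹ + 1, fun x hx => ?_⟩
    by_contra hlt
    push Not at hlt
    have hi : 0 < (B w w)⁻¹ := inv_pos.2 hm
    have hx0 : 0 < ‖x‖ := by linarith
    have hs : (‖x‖⁻¹ • x) ∈ Metric.sphere (0 : Cn n) 1 := by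
      simp [norm_smul, hx0.ne']
    have h2 : B w w ≤ ‖x‖⁻¹ * (‖x‖⁻¹ * B x x) := by
      have := hmin hs
      simpa using this
    have hx1 : B x x < 1 := hx
    have h3 : B w w * (‖x‖ * ‖x‖) ≤ B x x := by
      calc B w w * (‖x‖ * ‖x‖) ≤ ‖x‖⁻¹ * (‖x‖⁻¹ * B x x) * (‖x‖ * ‖x‖) := by gcongr
        _ = B x x := by field_simp
    have h4 : (B w w)⁻¹ * B w w = 1 := inv_mul_cancel₀ hm.ne'
    nlinarith [mul_pos hm hx0]

/-- The map `φ ↦ g_φ` from `𝓗_ω` to `𝓜`. -/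
def toMetric (K : KahlerStructure n M) (φ : kahlerPotentials K) : RiemMetric n M where
  inner p := metricTensor K φ p
  symm p u v := metricTensor_symm K φ p u v
  pos p v hv := φ.2 p v hv
  isVonNBounded p := isVonNBounded_of_pos (metricTensor K φ p) fun v hv => φ.2 p v hv
  contMDiff := by
    have h := K.metric.contMDiff.add_section (contMDiff_iddbar_cxJ φ.1.contMDiff)
    simp only [metricTensor_eq]
    exact h

lemma hasDerivAt_affine {F : Type*} [NormedAddCommGroup F] [NormedSpace ℝ F] (A B : F) :
    HasDerivAt (fun t : ℝ => A + t • B) B 0 := by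
  simpa using ((hasDerivAt_id (0 : ℝ)).smul_const B).const_add A

lemma deriv_affine {F : Type*} [NormedAddCommGroup F] [NormedSpace ℝ F] (A B : F) :
    deriv (fun t : ℝ => A + t • B) 0 = B :=
  (hasDerivAt_affine A B).deriv

lemma hasDerivAt_metricTensor (K : KahlerStructure n M) (φ ν : Smooth n M) (p : M) :
    HasDerivAt (fun t : ℝ => metricTensor K (φ + t • ν) p)
      ((ContinuousLinearMap.precomp ℝ (cxJ n p)).comp (iddbar n ν p)) 0 := by
  simp only [metricTensor_add_smul]
  exact hasDerivAt_affine (F := Cn n →L[ℝ] Cn n →L[ℝ] ℝ) _ _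

lemma deriv_metricTensor (K : KahlerStructure n M) (φ ν : Smooth n M) (p : M) :
    deriv (fun t : ℝ => metricTensor K (φ + t • ν) p) 0 =
      (ContinuousLinearMap.precomp ℝ (cxJ n p)).comp (iddbar n ν p) := by
  simp only [metricTensor_add_smul]
  exact deriv_affine (F := Cn n →L[ℝ] Cn n →L[ℝ] ℝ) _ _

/-- The differential at `φ` of the map `φ ↦ g_φ`: the tensor field `d/dt|_{t=0} g_{φ + tν}`. -/
def dToMetric (K : KahlerStructure n M) (φ : kahlerPotentials K) (ν : Smooth n M) :
    SymTensor n M where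
  toFun p := deriv (fun t : ℝ => metricTensor K (φ + t • ν) p) 0
  symm p u v := by
    rw [deriv_metricTensor]
    exact iddbar_cxJ_symm ν.contMDiff p u v
  contMDiff := by
    simp only [deriv_metricTensor]
    exact contMDiff_iddbar_cxJ ν.contMDiff

/-- The space `𝓗 ⊆ 𝓜` of Kähler metrics `g_φ`. -/
def kahlerMetrics (K : KahlerStructure n M) : Set (RiemMetric n M) := Set.range (toMetric K)

/-- The tangent space of `𝓗` at `g`, inside that of `𝓜`. -/
def kahlerTangent (K : KahlerStructure n M) (g : RiemMetric n M) : Set (SymTensor n M) :=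
  {h | ∃ (φ : kahlerPotentials K) (ν : Smooth n M), toMetric K φ = g ∧ dToMetric K φ ν = h}

end Metrics

section Integration

variable {n : ℕ} {M : Type*} [TopologicalSpace M] [ChartedSpace (Cn n) M]
  [IsManifold 𝓘(ℂ, Cn n) ω M] [T2Space M] [CompactSpace M]

variable (n M) in
/-- A smooth partition of unity on `M` subordinate to the domains of the charts. -/
def chartPartition : SmoothPartitionOfUnity M 𝓘(ℝ, Cn n) M Set.univ :=
  (SmoothPartitionOfUnity.exists_isSubordinate_chartAt_source 𝓘(ℝ, Cn n) M).choose

lemma chartPartition_isSubordinate :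
    (chartPartition n M).IsSubordinate fun c => (chartAt (Cn n) c).source :=
  (SmoothPartitionOfUnity.exists_isSubordinate_chartAt_source 𝓘(ℝ, Cn n) M).choose_spec

variable (n) in
/-- The integral over `M` of a density or of a top-degree form. Here `D c p` is its coefficient
at `p` with respect to `dx¹ dy¹ ⋯ dxⁿ dyⁿ`, respectively `dx¹ ∧ dy¹ ∧ ⋯ ∧ dxⁿ ∧ dyⁿ`, in the
coordinates of the preferred chart at `c`. The integral is `∑_c ∫ ρ_c D c` for a partition of unity
`ρ` subordinate to the charts; by the change of variables formula it does not depend on the choice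
of `ρ`. The holomorphic charts are positively oriented. -/
def manifoldIntegral (D : M → M → ℝ) : ℝ :=
  ∑ᶠ c : M, ∫ x in (chartAt (Cn n) c).target,
    chartPartition n M c ((chartAt (Cn n) c).symm x) * D c ((chartAt (Cn n) c).symm x)

variable (n) in
/-- The real basis `∂/∂x¹, …, ∂/∂xⁿ, ∂/∂y¹, …, ∂/∂yⁿ` of `ℂⁿ`. -/
def realBasis : Fin n ⊕ Fin n → Cn n :=
  Sum.elim (fun i => Pi.single i 1) (fun i => Pi.single i Complex.I)

/-- The matrix `h_{ij}` of a bilinear form on `T_p M` in the real coordinates of the preferred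
chart at `c`. -/
def realMatrix {p : M} (h : Tan n p →L[ℝ] Tan n p →L[ℝ] ℝ) (c : M) :
    Matrix (Fin n ⊕ Fin n) (Fin n ⊕ Fin n) ℝ :=
  Matrix.of fun i j => h (coordVec n c p (realBasis n i)) (coordVec n c p (realBasis n j))

/-- The coefficient `√det g_{ij}` of the Riemannian volume `dV_g`. -/
def volumeDensity (g : RiemMetric n M) (c p : M) : ℝ :=
  Real.sqrt (realMatrix (g.inner p) c).det

/-- The function `tr(g⁻¹ h g⁻¹ k)`. -/
def traceProduct (g : RiemMetric n M) (h k : SymTensor n M) (p : M) : ℝ :=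
  ((realMatrix (g.inner p) p)⁻¹ * realMatrix (h.toFun p) p *
    (realMatrix (g.inner p) p)⁻¹ * realMatrix (k.toFun p) p).trace

/-- The Ebin metric `g_E(h,k)|_g = ∫_M tr(g⁻¹ h g⁻¹ k) dV_g`. -/
def ebinMetric (g : RiemMetric n M) (h k : SymTensor n M) : ℝ :=
  manifoldIntegral n fun c p => traceProduct g h k p * volumeDensity g c p

/-- The Hermitian matrix `g_{i j̄} = g(∂/∂zⁱ, ∂/∂z̄ʲ)`, for the complex bilinear extension of a
real bilinear form `g` on `T_p M`, in the preferred holomorphic chart at `p`. -/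
def hermMatrix {p : M} (g : Tan n p →L[ℝ] Tan n p →L[ℝ] ℝ) : Matrix (Fin n) (Fin n) ℂ :=
  Matrix.of fun i j =>
    let x : Fin n → Tan n p := fun i => coordVec n p p (Pi.single i 1)
    let y : Fin n → Tan n p := fun i => coordVec n p p (Pi.single i Complex.I)
    (1 / 4) * ((g (x i) (x j) + g (y i) (y j) : ℝ) +
      Complex.I * (g (x i) (y j) - g (y i) (x j) : ℝ))

/-- The Laplacian `Δ_φ f = g_φ^{i j̄} ∂²f / ∂zⁱ ∂z̄ʲ` (the trace of `√-1 ∂∂̄ f` with respect to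
`ω_φ`). -/
def laplacian (K : KahlerStructure n M) (φ f : Smooth n M) (p : M) : ℝ :=
  ((hermMatrix (metricTensor K φ p))⁻¹ *
    cxHessian (f ∘ (chartAt (Cn n) p).symm) (chartAt (Cn n) p p)).trace.re

/-- The `m`-th exterior power `β ∧ ⋯ ∧ β` of an alternating bilinear form, evaluated on the `2m`
vectors `v₁₀, v₁₁, …, v_{m0}, v_{m1}`. -/
def wedgePow {V : Type*} (β : V → V → ℝ) (m : ℕ) (v : Fin m × Fin 2 → V) : ℝ :=
  (1 / 2 ^ m) * ∑ σ : Equiv.Perm (Fin m × Fin 2),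
    ((Equiv.Perm.sign σ : ℤ) : ℝ) * ∏ k, β (v (σ (k, 0))) (v (σ (k, 1)))

variable (n) in
/-- The oriented real frame `∂/∂x¹, ∂/∂y¹, …, ∂/∂xⁿ, ∂/∂yⁿ` of `ℂⁿ`. -/
def orientedBasis (k : Fin n × Fin 2) : Cn n :=
  if k.2 = 0 then Pi.single k.1 1 else Pi.single k.1 Complex.I

/-- The coefficient of the top-degree form `ω_φⁿ / n!`. -/
def volumeForm (K : KahlerStructure n M) (φ : Smooth n M) (c p : M) : ℝ :=
  wedgePow (fun u v => kahlerForm K φ p u v) n (fun k => coordVec n c p (orientedBasis n k)) /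
    (n.factorial : ℝ)

/-- The Calabi metric `g_C(ν,η)|_φ = ∫_M Δ_φ ν Δ_φ η ω_φⁿ / n!` on `𝓗_ω`. -/
def calabiMetric (K : KahlerStructure n M) (φ : kahlerPotentials K) (ν η : Smooth n M) : ℝ :=
  manifoldIntegral n fun c p => laplacian K φ ν p * laplacian K φ η p * volumeForm K φ c p

open Classical in
/-- The Calabi metric on `𝓗`, pushed forward by `φ ↦ g_φ`: its value at `g = g_φ` on the images
`h`, `k` of `ν`, `η` is `g_C(ν,η)|_φ`. -/
def calabiOnMetrics (K : KahlerStructure n M) (g : RiemMetric n M) (h k : SymTensor n M) : ℝ :=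
  if H : ∃ d : kahlerPotentials K × Smooth n M × Smooth n M,
      toMetric K d.1 = g ∧ dToMetric K d.1 d.2.1 = h ∧ dToMetric K d.1 d.2.2 = k then
    calabiMetric K H.choose.1 H.choose.2.1 H.choose.2.2
  else 0

end Integration

end

end Kahler

/-!
At a point, in coordinates, write `a`, `b`, `e` for the complex matrices of `g_φ`, `√-1∂∂̄ν`,
`√-1∂∂̄η`. The tensor `dg_φ(ν)` is `√-1∂∂̄ν(·, J·)`, so
`tr(g⁻¹ h g⁻¹ k) = 2 tr(a⁻¹ b a⁻¹ e)` (`traceProduct_eq`), while `Δ_φν Δ_φη = tr(a⁻¹ b) tr(a⁻¹ e)`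
(`laplacian_eq`), and both `dV_g` and `ω_φⁿ / n!` have coefficient `2ⁿ det a` (`volumeDensity_eq`,
`volumeForm_eq`). The two integrands differ by the polarised determinant
`det a (tr(a⁻¹ b) tr(a⁻¹ e) - tr(a⁻¹ b a⁻¹ e))`, which is the coefficient of
`√-1∂∂̄ν ∧ √-1∂∂̄η ∧ ω_φ^{n-2}` up to a constant, so the claim is that its integral vanishes.

Since `ω_φ` and `√-1∂∂̄ν` are closed, the derivative of the cofactor matrix of `a` in the direction
`b` has divergence-free columns (`sum_dzMatrix_mixedCofactor`), hence the polarised determinant is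
the divergence of a vector field that is linear in `∂̄η` (`mixedDet_eq_divergence`). Integrating
against a partition of unity `ρ` and integrating by parts in each chart
(`chartIntegral_mul_mixedDensity`) replaces `√-1∂∂̄η` by `-∂ρ_c ⊗ ∂̄η`. These terms are densities,
so by the change of variables formula (`chartIntegral_eq`) they may be collected in common charts,
where they add up to zero because `∑ ρ_c = 1` (`sum_chartIntegral_mixedDensity`). All densities are
handled as the Jacobian `jacobian n c p`, from the chart at `c` to the preferred chart at `p`, times
a function of `p`.

That `ω_φⁿ / n!` is the Riemannian volume follows by writing `a` as `Bᴴ B`: the top power of an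
alternating form scales by the real determinant `|det B|²`, and for the standard form it counts the
permutations that preserve the pairs `{xᵏ, yᵏ}`.

Finally, the Calabi metric descends to `𝓗` because it is half the Ebin metric, which only sees
`g_φ` and the tangent tensors.
-/

namespace Kahler

open MeasureTheory

noncomputable section

/-! ### Complex matrices as real matrices -/

/-- The real matrix `[[Re A, Im A], [-Im A, Re A]]` of a complex matrix `A`. -/
def realify {n : ℕ} (A : Matrix (Fin n) (Fin n) ℂ) :
    Matrix (Fin n ⊕ Fin n) (Fin n ⊕ Fin n) ℝ :=
  Matrix.fromBlocks (A.map Complex.re) (A.map Complex.im)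
    (-(A.map Complex.im)) (A.map Complex.re)

lemma realify_mul {n : ℕ} (A B : Matrix (Fin n) (Fin n) ℂ) :
    realify (A * B) = realify A * realify B := by
  rw [realify, realify, realify, Matrix.fromBlocks_multiply]
  congr 1 <;> ext i j <;>
    simp [Matrix.mul_apply, Finset.sum_sub_distrib, Finset.sum_add_distrib] <;> ring

lemma realify_one {n : ℕ} : realify (1 : Matrix (Fin n) (Fin n) ℂ) = 1 := by
  rw [realify, ← Matrix.fromBlocks_one]
  congr 1 <;> ext i j <;> by_cases h : i = j <;> simp [Matrix.one_apply, h]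

lemma trace_realify {n : ℕ} (A : Matrix (Fin n) (Fin n) ℂ) :
    (realify A).trace = 2 * A.trace.re := by
  simp [realify, Matrix.trace, Complex.re_sum, two_mul]

/-- Over `ℂ`, the matrix `realify A` is conjugate to `diag(A, Ā)`. -/
lemma det_realify {n : ℕ} (A : Matrix (Fin n) (Fin n) ℂ) :
    (realify A).det = Complex.normSq A.det := by
  let U : Matrix (Fin n ⊕ Fin n) (Fin n ⊕ Fin n) ℂ :=
    Matrix.fromBlocks 1 1 (Complex.I • 1) (-(Complex.I • 1))
  let V : Matrix (Fin n ⊕ Fin n) (Fin n ⊕ Fin n) ℂ :=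
    Matrix.fromBlocks 1 (-(Complex.I • 1)) 1 (Complex.I • 1)
  let D : Matrix (Fin n ⊕ Fin n) (Fin n ⊕ Fin n) ℂ :=
    Matrix.fromBlocks A 0 0 (A.map conj)
  have hUV : U * V = (2 : ℂ) • 1 := by
    simp only [U, V, Matrix.fromBlocks_multiply, ← Matrix.fromBlocks_one, Matrix.fromBlocks_smul]
    congr 1 <;> ext i j <;> by_cases h : i = j <;> simp [h] <;> norm_num
  have hU : U.det ≠ 0 := by
    intro h
    have := congrArg Matrix.det hUV
    rw [Matrix.det_mul, h, zero_mul, Matrix.det_smul, Matrix.det_one, mul_one] at this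
    exact pow_ne_zero _ two_ne_zero this.symm
  have hAU : (realify A).map Complex.ofReal * U = U * D := by
    simp only [U, D, realify, Matrix.fromBlocks_map, Matrix.fromBlocks_multiply]
    congr 1 <;> ext i j <;> apply Complex.ext <;> simp
  have h1 : ((realify A).map Complex.ofReal).det = D.det := by
    have := congrArg Matrix.det hAU
    rw [Matrix.det_mul, Matrix.det_mul, mul_comm] at this
    exact mul_left_cancel₀ hU this
  have h2 : D.det = (Complex.normSq A.det : ℂ) := by
    have h3 : (A.map conj).det = conj A.det := (RingHom.map_det (starRingEnd ℂ) A).symm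
    rw [Matrix.det_fromBlocks_zero₂₁, h3, Complex.mul_conj]
  have h4 : ((realify A).map Complex.ofReal).det = ((realify A).det : ℂ) :=
    (RingHom.map_det Complex.ofRealHom (realify A)).symm
  exact_mod_cast h4.symm.trans (h1.trans h2)

/-! ### The sesquilinear form of a real bilinear form -/

lemma mulI_eq {n : ℕ} (v : Cn n) : mulI n v = Complex.I • v := rfl

lemma mulI_single {n : ℕ} (i : Fin n) : mulI n (Pi.single i 1) = Pi.single i Complex.I := by
  ext j
  by_cases h : j = i
  · subst h; simp [mulI]
  · simp [mulI, h]

/-- The value `h(u^{1,0}, v^{0,1})` of the complex bilinear extension of `h` on the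
`(1,0)`-part of `u` and the `(0,1)`-part of `v`; it is sesquilinear in `u` and `v`. -/
def sesq {n : ℕ} (h : Cn n →L[ℝ] Cn n →L[ℝ] ℝ) (u v : Cn n) : ℂ :=
  (1 / 4) * (((h u v + h (mulI n u) (mulI n v) : ℝ) : ℂ) +
    Complex.I * ((h u (mulI n v) - h (mulI n u) v : ℝ) : ℂ))

lemma smul_eq_re_add_im {n : ℕ} (c : ℂ) (w : Cn n) :
    c • w = c.re • w + c.im • mulI n w := by
  ext i
  simp only [mulI_eq, Pi.smul_apply, Pi.add_apply, smul_eq_mul, Complex.real_smul]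
  conv_lhs => rw [← Complex.re_add_im c]
  ring

lemma sesq_expand_basis {n : ℕ} (h : Cn n →L[ℝ] Cn n →L[ℝ] ℝ) (u v : Cn n) :
    sesq h u v = ∑ i, ∑ j,
      sesq h (Pi.single i 1) (Pi.single j 1) * (u i * conj (v j)) := by
  apply sesq_expand (sesq h)
  · intro u u' v; simp only [sesq, map_add, add_apply]; push_cast; ring
  · intro u v v'; simp only [sesq, map_add]; push_cast; ring
  · intro c u v
    simp only [sesq, smul_eq_re_add_im, map_add, map_smul, map_neg, mulI_mulI, add_apply,
      smul_apply, neg_apply, smul_eq_mul]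
    apply Complex.ext <;> simp <;> ring
  · intro c u v
    simp only [sesq, smul_eq_re_add_im, map_add, map_smul, map_neg, mulI_mulI, smul_eq_mul]
    apply Complex.ext <;> simp <;> ring

/-- The matrix `h(T eᵢ^{1,0}, T eⱼ^{0,1})` of `h` in the frame `T e₁, …, T eₙ`. -/
def sesqMatrix {n : ℕ} (h : Cn n →L[ℝ] Cn n →L[ℝ] ℝ) (T : Cn n → Cn n) :
    Matrix (Fin n) (Fin n) ℂ :=
  Matrix.of fun i j => sesq h (T (Pi.single i 1)) (T (Pi.single j 1))

/-- The complex matrix of `T`, with columns `T e₁, …, T eₙ`. -/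
def frameMatrix {n : ℕ} (T : Cn n → Cn n) : Matrix (Fin n) (Fin n) ℂ :=
  Matrix.of fun k i => T (Pi.single i 1) k

lemma sesqMatrix_eq {n : ℕ} (h : Cn n →L[ℝ] Cn n →L[ℝ] ℝ) (T : Cn n → Cn n) :
    sesqMatrix h T =
      (frameMatrix T).transpose * sesqMatrix h id * (frameMatrix T).map conj := by
  ext i j
  simp only [sesqMatrix, Matrix.of_apply, Matrix.mul_apply, Matrix.transpose_apply,
    Matrix.map_apply, frameMatrix, id]
  rw [sesq_expand_basis, Finset.sum_comm]
  refine Finset.sum_congr rfl fun l _ => ?_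
  rw [Finset.sum_mul]
  refine Finset.sum_congr rfl fun k _ => ?_
  ring

/-- A complex linear map of matrix `L` has real determinant `|det L|²`. -/
lemma det_eq_normSq_frameMatrix {n : ℕ} (T : Cn n →ₗ[ℝ] Cn n)
    (hT : ∀ v, T (mulI n v) = mulI n (T v)) :
    LinearMap.det T = Complex.normSq (frameMatrix T).det := by
  let S : Cn n →ₗ[ℂ] Cn n :=
    { toFun := T
      map_add' := map_add T
      map_smul' := fun c v => by
        simp only [smul_eq_re_add_im, map_add, map_smul, hT, RingHom.id_apply] }
  have h1 : S.restrictScalars ℝ = T := rfl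
  have h2 : frameMatrix T = LinearMap.toMatrix' S := by
    ext i j
    rw [LinearMap.toMatrix'_apply]
    simp only [frameMatrix, Matrix.of_apply]
    rfl
  rw [← h1, LinearMap.det_restrictScalars, Algebra.norm_complex_apply, h1, h2,
    LinearMap.det_toMatrix']

lemma invariant_left {n : ℕ} {h : Cn n →L[ℝ] Cn n →L[ℝ] ℝ}
    (hJ : ∀ u v, h (mulI n u) (mulI n v) = h u v) (u v : Cn n) :
    h (mulI n u) v = -h u (mulI n v) := by
  have := hJ u (mulI n v)
  rw [mulI_mulI, map_neg] at this
  linarith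

/-- For a `J`-invariant form, `h(u^{1,0}, v^{0,1}) = (h(u,v) + i h(u,Jv)) / 2`. -/
lemma sesq_of_invariant {n : ℕ} {h : Cn n →L[ℝ] Cn n →L[ℝ] ℝ}
    (hJ : ∀ u v, h (mulI n u) (mulI n v) = h u v) (u v : Cn n) :
    sesq h u v = (1 / 2) * ((h u v : ℂ) + Complex.I * (h u (mulI n v) : ℂ)) := by
  rw [sesq, hJ, invariant_left hJ]
  push_cast
  ring

lemma isHermitian_sesqMatrix {n : ℕ} {h : Cn n →L[ℝ] Cn n →L[ℝ] ℝ}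
    (hs : ∀ u v, h u v = h v u) (T : Cn n → Cn n) :
    (sesqMatrix h T).IsHermitian := by
  ext i j
  simp only [sesqMatrix, Matrix.conjTranspose_apply, Matrix.of_apply, sesq]
  rw [hs (T (Pi.single j 1)), hs (mulI n (T (Pi.single j 1))), hs (T (Pi.single j 1)),
    hs (mulI n (T (Pi.single j 1)))]
  apply Complex.ext <;> simp

open scoped ComplexOrder in
lemma posDef_sesqMatrix {n : ℕ} {h : Cn n →L[ℝ] Cn n →L[ℝ] ℝ}
    (hs : ∀ u v, h u v = h v u) (hp : ∀ v, v ≠ 0 → 0 < h v v) :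
    (sesqMatrix h id).PosDef := by
  refine Matrix.PosDef.of_dotProduct_mulVec_pos (isHermitian_sesqMatrix hs id) fun x hx => ?_
  have h1 : star x ⬝ᵥ (sesqMatrix h id).mulVec x = sesq h (star x) (star x) := by
    rw [sesq_expand_basis]
    simp only [dotProduct, Matrix.mulVec, Finset.mul_sum, sesqMatrix, Matrix.of_apply, id,
      Pi.star_apply]
    refine Finset.sum_congr rfl fun i _ => Finset.sum_congr rfl fun j _ => ?_
    simp
    ring
  have hx' : star x ≠ 0 := by simpa using hx
  have hx'' : mulI n (star x) ≠ 0 := by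
    rw [mulI_eq]; exact smul_ne_zero Complex.I_ne_zero hx'
  have h2 : sesq h (star x) (star x) =
      (((h (star x) (star x) + h (mulI n (star x)) (mulI n (star x))) / 4 : ℝ) : ℂ) := by
    rw [sesq, hs (mulI n (star x)) (star x)]
    push_cast
    ring
  rw [h1, h2]
  have := hp _ hx'
  have := hp _ hx''
  exact_mod_cast (by positivity : (0 : ℝ) <
    (h (star x) (star x) + h (mulI n (star x)) (mulI n (star x))) / 4)

/-! ### The polarised determinant -/

/-- The coefficient of `√-1∂∂̄ν ∧ √-1∂∂̄η ∧ ω^{n-2}` up to a constant: for invertible `a`, the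
mixed derivative
`∂²/∂s∂t` at `0` of `det (a + s b + t e)`. -/
def mixedDet {n : ℕ} (a b e : Matrix (Fin n) (Fin n) ℂ) : ℂ :=
  a.det * ((a⁻¹ * b).trace * (a⁻¹ * e).trace - (a⁻¹ * b * a⁻¹ * e).trace)

lemma trace_congr {n : ℕ} {L a b : Matrix (Fin n) (Fin n) ℂ} (hL : L.det ≠ 0) :
    ((L.transpose * a * L.map conj)⁻¹ * (L.transpose * b * L.map conj)).trace =
      (a⁻¹ * b).trace := by
  have h1 : IsUnit L.transpose.det := by rw [Matrix.det_transpose]; exact isUnit_iff_ne_zero.2 hL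
  have h3 : (L.map conj).det = conj L.det := (RingHom.map_det (starRingEnd ℂ) L).symm
  have h2 : IsUnit (L.map conj).det := by rw [h3]; simpa using hL
  rw [Matrix.mul_inv_rev, Matrix.mul_inv_rev]
  have : (L.map conj)⁻¹ * (a⁻¹ * L.transpose⁻¹) * (L.transpose * b * L.map conj) =
      (L.map conj)⁻¹ * (a⁻¹ * (L.transpose⁻¹ * L.transpose) * b * L.map conj) := by
    simp only [Matrix.mul_assoc]
  rw [this, Matrix.nonsing_inv_mul _ h1, Matrix.trace_mul_comm, Matrix.mul_assoc,
    Matrix.mul_nonsing_inv _ h2]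
  simp

lemma trace_congr_mul {n : ℕ} {L a b e : Matrix (Fin n) (Fin n) ℂ} (hL : L.det ≠ 0) :
    ((L.transpose * a * L.map conj)⁻¹ * (L.transpose * b * L.map conj) *
      (L.transpose * a * L.map conj)⁻¹ * (L.transpose * e * L.map conj)).trace =
      (a⁻¹ * b * a⁻¹ * e).trace := by
  have h1 : IsUnit L.transpose.det := by rw [Matrix.det_transpose]; exact isUnit_iff_ne_zero.2 hL
  have h3 : (L.map conj).det = conj L.det := (RingHom.map_det (starRingEnd ℂ) L).symm
  have h2 : IsUnit (L.map conj).det := by rw [h3]; simpa using hL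
  have h4 : L.transpose * b * L.map conj * (L.transpose * a * L.map conj)⁻¹ *
      (L.transpose * e * L.map conj) = L.transpose * (b * a⁻¹ * e) * L.map conj := by
    rw [Matrix.mul_inv_rev, Matrix.mul_inv_rev]
    have : L.transpose * b * L.map conj * ((L.map conj)⁻¹ * (a⁻¹ * L.transpose⁻¹)) *
        (L.transpose * e * L.map conj) = L.transpose * b * (L.map conj * (L.map conj)⁻¹) *
        a⁻¹ * (L.transpose⁻¹ * L.transpose) * e * L.map conj := by
      simp only [Matrix.mul_assoc]
    rw [this, Matrix.nonsing_inv_mul _ h1, Matrix.mul_nonsing_inv _ h2]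
    simp only [Matrix.mul_assoc, Matrix.mul_one]
  have h5 := trace_congr (a := a) (b := b * a⁻¹ * e) hL
  rw [← h4] at h5
  simpa only [Matrix.mul_assoc] using h5

lemma det_congr {n : ℕ} (L a : Matrix (Fin n) (Fin n) ℂ) :
    (L.transpose * a * L.map conj).det = Complex.normSq L.det * a.det := by
  have h3 : (L.map conj).det = conj L.det := (RingHom.map_det (starRingEnd ℂ) L).symm
  rw [Matrix.det_mul, Matrix.det_mul, Matrix.det_transpose, h3, ← Complex.mul_conj]
  ring

lemma mixedDet_congr {n : ℕ} {L : Matrix (Fin n) (Fin n) ℂ} (hL : L.det ≠ 0)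
    (a b e : Matrix (Fin n) (Fin n) ℂ) :
    mixedDet (L.transpose * a * L.map conj) (L.transpose * b * L.map conj)
      (L.transpose * e * L.map conj) = Complex.normSq L.det * mixedDet a b e := by
  rw [mixedDet, mixedDet, trace_congr hL, trace_congr hL, trace_congr_mul hL, det_congr]
  ring

/-! ### The top exterior power of the Kähler form -/

/-- The product `∏ₖ β(v_{k0}, v_{k1})` as a multilinear map in the vectors `v`; its
alternatization is a multiple of `β ∧ ⋯ ∧ β`. -/
def pairProd {V : Type*} [AddCommGroup V] [Module ℝ V] (β : V →ₗ[ℝ] V →ₗ[ℝ] ℝ) (m : ℕ) :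
    MultilinearMap ℝ (fun _ : Fin m × Fin 2 => V) ℝ where
  toFun v := ∏ k, β (v (k, 0)) (v (k, 1))
  map_update_add' {dec} v i x y := by
    obtain ⟨k, j⟩ := i
    rw [Subsingleton.elim dec inferInstance]
    have h : ∀ z : V, ∏ l ∈ Finset.univ.erase k, β (Function.update v (k, j) z (l, 0))
        (Function.update v (k, j) z (l, 1)) =
        ∏ l ∈ Finset.univ.erase k, β (v (l, 0)) (v (l, 1)) := fun z => by
      refine Finset.prod_congr rfl fun l hl => ?_
      have hl' : l ≠ k := Finset.ne_of_mem_erase hl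
      rw [Function.update_of_ne (by simp [hl']), Function.update_of_ne (by simp [hl'])]
    simp only [← Finset.mul_prod_erase Finset.univ _ (Finset.mem_univ k), h]
    fin_cases j <;> simp [add_mul]
  map_update_smul' {dec} v i c x := by
    obtain ⟨k, j⟩ := i
    rw [Subsingleton.elim dec inferInstance]
    have h : ∀ z : V, ∏ l ∈ Finset.univ.erase k, β (Function.update v (k, j) z (l, 0))
        (Function.update v (k, j) z (l, 1)) =
        ∏ l ∈ Finset.univ.erase k, β (v (l, 0)) (v (l, 1)) := fun z => by
      refine Finset.prod_congr rfl fun l hl => ?_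
      have hl' : l ≠ k := Finset.ne_of_mem_erase hl
      rw [Function.update_of_ne (by simp [hl']), Function.update_of_ne (by simp [hl'])]
    simp only [← Finset.mul_prod_erase Finset.univ _ (Finset.mem_univ k), h]
    fin_cases j <;> simp [mul_assoc]

lemma wedgePow_eq_alternatization {V : Type*} [AddCommGroup V] [Module ℝ V]
    (β : V →ₗ[ℝ] V →ₗ[ℝ] ℝ) (m : ℕ) (v : Fin m × Fin 2 → V) :
    wedgePow (fun x y => β x y) m v =
      (1 / 2 ^ m) * MultilinearMap.alternatization (pairProd β m) v := by
  rw [wedgePow, MultilinearMap.alternatization_apply]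
  congr 1
  refine Finset.sum_congr rfl fun σ _ => ?_
  rw [MultilinearMap.domDomCongr_apply, Units.smul_def, zsmul_eq_mul]
  rfl

/-- The oriented frame of `ℂⁿ` as a basis over `ℝ`. -/
def realOrientedBasis (n : ℕ) : Module.Basis (Fin n × Fin 2) ℝ (Cn n) :=
  (Pi.basis fun _ : Fin n => Complex.basisOneI).reindex (Equiv.sigmaEquivProd (Fin n) (Fin 2))

lemma coe_realOrientedBasis (n : ℕ) : ⇑(realOrientedBasis n) = orientedBasis n := by
  ext1 k
  obtain ⟨k, j⟩ := k
  rw [realOrientedBasis, Module.Basis.reindex_apply]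
  simp only [Equiv.sigmaEquivProd_symm_apply, Pi.basis_apply, Complex.coe_basisOneI, orientedBasis]
  fin_cases j <;> simp

/-- The top power of `T^*β` on the standard frame is `det T` times that of `β`. -/
lemma wedgePow_comp {n : ℕ} (β : Cn n →ₗ[ℝ] Cn n →ₗ[ℝ] ℝ) (T : Cn n →ₗ[ℝ] Cn n) :
    wedgePow (fun x y => β (T x) (T y)) n (orientedBasis n) =
      LinearMap.det T * wedgePow (fun x y => β x y) n (orientedBasis n) := by
  have h1 : wedgePow (fun x y => β (T x) (T y)) n (orientedBasis n) =
      wedgePow (fun x y => β x y) n (T ∘ orientedBasis n) := rfl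
  rw [h1, wedgePow_eq_alternatization, wedgePow_eq_alternatization]
  set f := MultilinearMap.alternatization (pairProd β n)
  have h2 := f.eq_smul_basis_det (realOrientedBasis n)
  rw [← coe_realOrientedBasis]
  have h3 : f (T ∘ realOrientedBasis n) = f (realOrientedBasis n) * LinearMap.det T := by
    conv_lhs => rw [h2]
    rw [AlternatingMap.smul_apply, Module.Basis.det_comp, Module.Basis.det_self, mul_one,
      smul_eq_mul]
  rw [h3]
  ring

/-- The values of `dx ∧ dy` on the frame `∂/∂x, ∂/∂y`. -/
def planeArea (i j : Fin 2) : ℤ := if i = j then 0 else if i = 0 then 1 else -1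

lemma planeArea_perm : ∀ τ : Equiv.Perm (Fin 2), planeArea (τ 0) (τ 1) = Equiv.Perm.sign τ := by
  decide

/-- The permutations of `Fin n × Fin 2` that permute the pairs `{(k,0), (k,1)}` are those given by
a permutation of `Fin n` and one of `Fin 2` for each pair. -/
lemma sum_sign_pairs (n : ℕ) :
    ∑ σ : Equiv.Perm (Fin n × Fin 2), (Equiv.Perm.sign σ : ℤ) *
      ∏ k, (if (σ (k, 0)).1 = (σ (k, 1)).1 then planeArea (σ (k, 0)).2 (σ (k, 1)).2 else 0) =
    2 ^ n * n.factorial := by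
  -- `(π, τ)` gives the permutation `(k, i) ↦ (π k, τₖ i)`, whose sign is `∏ₖ sign τₖ` because
  -- `π` acts on two copies of `Fin n`.
  let E : Equiv.Perm (Fin n) × (Fin n → Equiv.Perm (Fin 2)) → Equiv.Perm (Fin n × Fin 2) :=
    fun d => (Equiv.prodCongrRight d.2).trans (Equiv.prodCongrLeft fun _ => d.1)
  have hE : ∀ d k i, E d (k, i) = (d.1 k, d.2 k i) := fun d k i => rfl
  have hsign : ∀ d, (Equiv.Perm.sign (E d) : ℤ) = ∏ k, (Equiv.Perm.sign (d.2 k) : ℤ) := fun d => by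
    have h1 : E d = (Equiv.prodCongrLeft fun _ => d.1 : Equiv.Perm (Fin n × Fin 2)) *
      (Equiv.prodCongrRight d.2 : Equiv.Perm (Fin n × Fin 2)) := rfl
    rw [h1, map_mul, Equiv.Perm.sign_prodCongrLeft, Equiv.Perm.sign_prodCongrRight]
    simp [Units.coe_prod]
  have hcard : ∑ _d : Equiv.Perm (Fin n) × (Fin n → Equiv.Perm (Fin 2)), (1 : ℤ) =
      2 ^ n * n.factorial := by
    simp [Fintype.card_perm, mul_comm]
  rw [← hcard]
  symm
  refine Finset.sum_of_injOn E ?_ (fun _ _ => Finset.mem_coe.2 (Finset.mem_univ _)) ?_ ?_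
  · intro d _ d' _ hd
    have h : ∀ k i, (d.1 k, d.2 k i) = (d'.1 k, d'.2 k i) := fun k i => by
      rw [← hE, ← hE, hd]
    refine Prod.ext (Equiv.ext fun k => (Prod.ext_iff.1 (h k 0)).1) ?_
    exact funext fun k => Equiv.ext fun i => (Prod.ext_iff.1 (h k i)).2
  · intro σ _ hσ
    by_contra hne
    have hgood : ∀ k, (σ (k, 0)).1 = (σ (k, 1)).1 := fun k => by
      by_contra hk
      exact hne (mul_eq_zero_of_right _ (Finset.prod_eq_zero (Finset.mem_univ k) (if_neg hk)))
    have hfst : ∀ k i, (σ (k, i)).1 = (σ (k, 0)).1 := fun k i => by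
      fin_cases i
      · rfl
      · exact (hgood k).symm
    have hsurj : Function.Surjective fun k => (σ (k, 0)).1 := fun l => by
      refine ⟨(σ.symm (l, 0)).1, ?_⟩
      change (σ ((σ.symm (l, 0)).1, 0)).1 = l
      rw [← hfst _ (σ.symm (l, 0)).2, Prod.mk.eta, Equiv.apply_symm_apply]
    have hinj : ∀ k, Function.Injective fun i => (σ (k, i)).2 := fun k i i' hi => by
      have : σ (k, i) = σ (k, i') := Prod.ext ((hfst k i).trans (hfst k i').symm) hi
      exact (Prod.ext_iff.1 (σ.injective this)).2
    refine hσ ⟨(Equiv.ofBijective _ (Finite.injective_iff_bijective.1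
      (Finite.injective_iff_surjective.2 hsurj)), fun k => Equiv.ofBijective _
      (Finite.injective_iff_bijective.1 (hinj k))), by simp, ?_⟩
    ext1 ⟨k, i⟩
    rw [hE]
    exact Prod.ext (hfst k i).symm rfl
  · intro d _
    simp only [hE, if_true, planeArea_perm, hsign, ← Finset.prod_mul_distrib]
    symm
    refine Finset.prod_eq_one fun k _ => ?_
    rw [← Units.val_mul, Int.units_mul_self, Units.val_one]

/-- Twice the standard symplectic form `∑ dxᵏ ∧ dyᵏ` of `ℂⁿ`. -/
def twoStdForm (n : ℕ) : Cn n →ₗ[ℝ] Cn n →ₗ[ℝ] ℝ :=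
  LinearMap.mk₂ ℝ (fun u v => -2 * (∑ k, u k * conj (v k)).im)
    (fun u u' v => by simp [add_mul, Finset.sum_add_distrib]; ring)
    (fun c u v => by
      simp only [Pi.smul_apply, Complex.real_smul, mul_assoc, ← Finset.mul_sum,
        Complex.im_ofReal_mul, smul_eq_mul]
      ring)
    (fun u v v' => by simp [mul_add, Finset.sum_add_distrib])
    (fun c u v => by
      have : ∀ k, u k * conj ((c • v) k) = c * (u k * conj (v k)) := fun k => by simp; ring
      simp only [this, ← Finset.mul_sum, Complex.im_ofReal_mul, smul_eq_mul]
      ring)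

lemma twoStdForm_orientedBasis (n : ℕ) (a b : Fin n × Fin 2) :
    twoStdForm n (orientedBasis n a) (orientedBasis n b) =
      2 * ((if a.1 = b.1 then planeArea a.2 b.2 else 0 : ℤ) : ℝ) := by
  obtain ⟨k, i⟩ := a
  obtain ⟨l, j⟩ := b
  have h : ∀ z w : ℂ, (∑ m, (Pi.single k z : Cn n) m * conj ((Pi.single l w : Cn n) m)) =
      if k = l then z * conj w else 0 := fun z w => by
    rw [Finset.sum_eq_single k (fun m _ hm => by simp [hm]) (by simp)]
    by_cases hkl : k = l
    · subst hkl; simp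
    · simp [hkl]
  have hb : ∀ (m : Fin n) (i : Fin 2), orientedBasis n (m, i) =
      Pi.single m (if i = 0 then 1 else Complex.I) := fun m i => by
    by_cases hi : i = 0 <;> simp [orientedBasis, hi]
  simp only [twoStdForm, LinearMap.mk₂_apply, hb, h]
  by_cases hkl : k = l
  · fin_cases i <;> fin_cases j <;> simp [hkl, planeArea]
  · simp [hkl]

lemma wedgePow_twoStdForm (n : ℕ) :
    wedgePow (fun x y => twoStdForm n x y) n (orientedBasis n) = 2 ^ n * n.factorial := by
  have h := congrArg (Int.cast : ℤ → ℝ) (sum_sign_pairs n)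
  push_cast at h
  simp only [wedgePow, twoStdForm_orientedBasis, Finset.prod_mul_distrib, Finset.prod_const,
    Finset.card_univ, Fintype.card_fin, mul_left_comm _ ((2 : ℝ) ^ n), ← Finset.mul_sum]
  push_cast
  rw [h]
  field_simp

open scoped ComplexOrder in
open scoped MatrixOrder Matrix.Norms.L2Operator in
lemma exists_eq_conjTranspose_mul {n : ℕ} {A : Matrix (Fin n) (Fin n) ℂ} (hA : A.PosDef) :
    ∃ B : Matrix (Fin n) (Fin n) ℂ, A = B.conjTranspose * B :=
  CStarAlgebra.nonneg_iff_eq_star_mul_self.1 hA.posSemidef.nonneg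

open scoped ComplexOrder in
/-- For `β = √-1 A_{i j̄} dzⁱ ∧ dz̄ʲ` with `A` positive, `βⁿ / n!` has coefficient `2ⁿ det A`. -/
lemma wedgePow_posDef {n : ℕ} {A : Matrix (Fin n) (Fin n) ℂ} (hA : A.PosDef) :
    wedgePow (fun u v : Cn n => -2 * (∑ i, ∑ j, A i j * (u i * conj (v j))).im) n
      (orientedBasis n) = 2 ^ n * n.factorial * A.det.re := by
  obtain ⟨B, rfl⟩ := exists_eq_conjTranspose_mul hA
  let T : Cn n →ₗ[ℝ] Cn n := (Matrix.toLin' (B.map conj)).restrictScalars ℝ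
  have hT : ∀ u k, T u k = ∑ i, conj (B k i) * u i := fun u k => rfl
  have h1 : ∀ u v : Cn n, -2 * (∑ i, ∑ j, (B.conjTranspose * B) i j * (u i * conj (v j))).im =
      twoStdForm n (T u) (T v) := fun u v => by
    simp only [twoStdForm, LinearMap.mk₂_apply, hT, Matrix.mul_apply, Matrix.conjTranspose_apply,
      map_sum, Finset.sum_mul]
    congr 2
    conv_rhs => rw [Finset.sum_comm]
    refine Finset.sum_congr rfl fun i _ => ?_
    rw [Finset.sum_comm]
    refine Finset.sum_congr rfl fun k _ => ?_
    rw [Finset.mul_sum]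
    refine Finset.sum_congr rfl fun j _ => ?_
    simp
    ring
  simp only [h1]
  have hTJ : ∀ v, T (mulI n v) = mulI n (T v) := fun v =>
    map_smul (Matrix.toLin' (B.map conj)) Complex.I v
  have h2 : frameMatrix T = B.map conj := by
    ext k i
    rw [frameMatrix, Matrix.of_apply, hT]
    simp [Pi.single_apply]
  have h3 : (B.map conj).det = conj B.det := (RingHom.map_det (starRingEnd ℂ) B).symm
  have h4 : (B.conjTranspose * B).det = (Complex.normSq B.det : ℂ) := by
    rw [Matrix.det_mul, Matrix.det_conjTranspose, ← Complex.mul_conj]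
    exact mul_comm _ _
  rw [wedgePow_comp, wedgePow_twoStdForm, det_eq_normSq_frameMatrix T hTJ, h2, h3,
    Complex.normSq_conj, h4, Complex.ofReal_re]
  ring

/-! ### Wirtinger derivatives -/

section Wirtinger

variable {n : ℕ} {x : Cn n}

lemma dz_congr {F G : Cn n → ℂ} (h : F =ᶠ[𝓝 x] G) (i : Fin n) : dz i F x = dz i G x := by
  rw [dz, dz, h.fderiv_eq]

lemma dz_const (c : ℂ) (i : Fin n) : dz i (fun _ => c) x = 0 := by
  simp [dz]

lemma dz_add {F G : Cn n → ℂ} (hF : DifferentiableAt ℝ F x) (hG : DifferentiableAt ℝ G x)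
    (i : Fin n) : dz i (fun y => F y + G y) x = dz i F x + dz i G x := by
  have h : fderiv ℝ (fun y => F y + G y) x = fderiv ℝ F x + fderiv ℝ G x := fderiv_add hF hG
  simp only [dz, h, add_apply]
  ring

lemma dz_sub {F G : Cn n → ℂ} (hF : DifferentiableAt ℝ F x) (hG : DifferentiableAt ℝ G x)
    (i : Fin n) : dz i (fun y => F y - G y) x = dz i F x - dz i G x := by
  have h : fderiv ℝ (fun y => F y - G y) x = fderiv ℝ F x - fderiv ℝ G x := fderiv_sub hF hG
  simp only [dz, h, sub_apply]
  ring

lemma dz_mul {F G : Cn n → ℂ} (hF : DifferentiableAt ℝ F x) (hG : DifferentiableAt ℝ G x)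
    (i : Fin n) : dz i (fun y => F y * G y) x = dz i F x * G x + F x * dz i G x := by
  have h : fderiv ℝ (fun y => F y * G y) x = F x • fderiv ℝ G x + G x • fderiv ℝ F x :=
    fderiv_mul hF hG
  simp only [dz, h, add_apply, smul_apply, smul_eq_mul]
  ring

lemma dz_sum {ι : Type*} (s : Finset ι) {F : ι → Cn n → ℂ}
    (hF : ∀ k ∈ s, DifferentiableAt ℝ (F k) x) (i : Fin n) :
    dz i (fun y => ∑ k ∈ s, F k y) x = ∑ k ∈ s, dz i (F k) x := by
  have h : fderiv ℝ (fun y => ∑ k ∈ s, F k y) x = ∑ k ∈ s, fderiv ℝ (F k) x := fderiv_fun_sum hF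
  simp only [dz, h, sum_apply, Finset.mul_sum, ← Finset.sum_sub_distrib]

lemma dz_prod {ι : Type*} [DecidableEq ι] (s : Finset ι) {F : ι → Cn n → ℂ}
    (hF : ∀ k ∈ s, DifferentiableAt ℝ (F k) x) (i : Fin n) :
    dz i (fun y => ∏ k ∈ s, F k y) x =
      ∑ k ∈ s, (∏ l ∈ s.erase k, F l x) * dz i (F k) x := by
  have h := (HasFDerivAt.finsetProd (u := s) fun k hk => (hF k hk).hasFDerivAt).fderiv
  simp only [dz, h, sum_apply, Finset.mul_sum, ← Finset.sum_sub_distrib,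
    smul_apply, smul_eq_mul]
  exact Finset.sum_congr rfl fun k _ => by ring

/-- The matrix of Wirtinger derivatives `∂a_{ij}/∂zᵏ`. -/
def dzMatrix (k : Fin n) (a : Cn n → Matrix (Fin n) (Fin n) ℂ) (x : Cn n) :
    Matrix (Fin n) (Fin n) ℂ :=
  Matrix.of fun i j => dz k (fun y => a y i j) x

variable {a b : Cn n → Matrix (Fin n) (Fin n) ℂ}

lemma dzMatrix_mul (ha : ∀ i j, DifferentiableAt ℝ (fun y => a y i j) x)
    (hb : ∀ i j, DifferentiableAt ℝ (fun y => b y i j) x) (k : Fin n) :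
    dzMatrix k (fun y => a y * b y) x = dzMatrix k a x * b x + a x * dzMatrix k b x := by
  ext i j
  simp only [dzMatrix, Matrix.of_apply, Matrix.add_apply, Matrix.mul_apply]
  rw [dz_sum (F := fun l y => a y i l * b y l j) _ fun l _ => (ha i l).mul (hb l j),
    ← Finset.sum_add_distrib]
  exact Finset.sum_congr rfl fun l _ => dz_mul (ha i l) (hb l j) k

lemma dz_trace (ha : ∀ i j, DifferentiableAt ℝ (fun y => a y i j) x) (k : Fin n) :
    dz k (fun y => (a y).trace) x = (dzMatrix k a x).trace :=
  dz_sum _ (fun i _ => ha i i) k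

/-- Jacobi's formula. -/
lemma dz_det (ha : ∀ i j, DifferentiableAt ℝ (fun y => a y i j) x) (k : Fin n) :
    dz k (fun y => (a y).det) x = ((a x).adjugate * dzMatrix k a x).trace := by
  have h1 : dz k (fun y => (a y).det) x = ∑ σ : Equiv.Perm (Fin n), ∑ i,
      ((Equiv.Perm.sign σ : ℤ) : ℂ) *
        ((∏ l ∈ Finset.univ.erase i, a x (σ l) l) * dz k (fun y => a y (σ i) i) x) := by
    simp only [Matrix.det_apply']
    have hd : ∀ σ : Equiv.Perm (Fin n), DifferentiableAt ℝ (fun y => ∏ i, a y (σ i) i) x :=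
      fun σ => (HasFDerivAt.finsetProd fun i _ => (ha (σ i) i).hasFDerivAt).differentiableAt
    rw [dz_sum _ fun σ _ => (hd σ).const_mul _]
    refine Finset.sum_congr rfl fun σ _ => ?_
    rw [dz_mul (differentiableAt_const _) (hd σ), dz_const, zero_mul, zero_add,
      dz_prod _ fun i _ => ha (σ i) i, Finset.mul_sum]
  have h2 : ∀ i, ((a x).adjugate * dzMatrix k a x) i i = ∑ σ : Equiv.Perm (Fin n),
      ((Equiv.Perm.sign σ : ℤ) : ℂ) *
        ((∏ l ∈ Finset.univ.erase i, a x (σ l) l) * dz k (fun y => a y (σ i) i) x) := fun i => by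
    have h3 : ((a x).adjugate * dzMatrix k a x) i i =
        ((a x).adjugate.mulVec fun p => dzMatrix k a x p i) i := rfl
    rw [h3, ← Matrix.cramer_eq_adjugate_mulVec, Matrix.cramer_apply, Matrix.det_apply']
    refine Finset.sum_congr rfl fun σ _ => ?_
    congr 1
    rw [← Finset.mul_prod_erase _ _ (Finset.mem_univ i), mul_comm]
    congr 1
    · refine Finset.prod_congr rfl fun l hl => ?_
      rw [Matrix.updateCol_ne (Finset.ne_of_mem_erase hl)]
    · rw [Matrix.updateCol_self]
      rfl
  rw [h1, Finset.sum_comm, Matrix.trace]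
  exact Finset.sum_congr rfl fun i _ => (h2 i).symm

lemma contDiffAt_det {m : WithTop ℕ∞} {ι : Type*} [Fintype ι] [DecidableEq ι]
    {a : Cn n → Matrix ι ι ℂ} (ha : ∀ i j, ContDiffAt ℝ m (fun y => a y i j) x) :
    ContDiffAt ℝ m (fun y => (a y).det) x := by
  simp only [Matrix.det_apply']
  exact ContDiffAt.sum fun σ _ => contDiffAt_const.mul (contDiffAt_prod fun i _ => ha (σ i) i)

lemma contDiffAt_inv {m : WithTop ℕ∞} (ha : ∀ i j, ContDiffAt ℝ m (fun y => a y i j) x)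
    (h0 : (a x).det ≠ 0) (i j : Fin n) : ContDiffAt ℝ m (fun y => (a y)⁻¹ i j) x := by
  simp only [Matrix.inv_def, Matrix.smul_apply, Ring.inverse_eq_inv', smul_eq_mul,
    Matrix.adjugate_apply]
  refine ((contDiffAt_det ha).inv h0).mul (contDiffAt_det fun k l => ?_)
  simp only [Matrix.updateRow_apply]
  split_ifs
  · exact contDiffAt_const
  · exact ha k l

lemma contDiffAt_mul {m : WithTop ℕ∞} (ha : ∀ i j, ContDiffAt ℝ m (fun y => a y i j) x)
    (hb : ∀ i j, ContDiffAt ℝ m (fun y => b y i j) x) (i j : Fin n) :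
    ContDiffAt ℝ m (fun y => (a y * b y) i j) x := by
  simp only [Matrix.mul_apply]
  exact ContDiffAt.sum fun k _ => (ha i k).mul (hb k j)

lemma contDiffAt_trace {m : WithTop ℕ∞} (ha : ∀ i j, ContDiffAt ℝ m (fun y => a y i j) x) :
    ContDiffAt ℝ m (fun y => (a y).trace) x :=
  ContDiffAt.sum fun i _ => ha i i

lemma dzMatrix_inv (ha : ∀ i j, ContDiffAt ℝ 1 (fun y => a y i j) x) (h0 : (a x).det ≠ 0)
    (k : Fin n) : dzMatrix k (fun y => (a y)⁻¹) x = -((a x)⁻¹ * dzMatrix k a x * (a x)⁻¹) := by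
  have ha' := fun i j => (ha i j).differentiableAt one_ne_zero
  have hW := fun i j => (contDiffAt_inv ha h0 i j).differentiableAt one_ne_zero
  have h1 : dzMatrix k (fun y => a y * (a y)⁻¹) x = 0 := by
    have h2 : ∀ᶠ y in 𝓝 x, a y * (a y)⁻¹ = 1 := by
      filter_upwards [(contDiffAt_det ha).continuousAt.eventually_ne h0] with y hy
      exact Matrix.mul_nonsing_inv _ (isUnit_iff_ne_zero.2 hy)
    ext i j
    rw [dzMatrix, Matrix.of_apply, dz_congr (G := fun _ => (1 : Matrix (Fin n) (Fin n) ℂ) i j)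
      (h2.mono fun y hy => by simp only [hy]), dz_const]
    rfl
  rw [dzMatrix_mul ha' hW] at h1
  have h3 := congrArg ((a x)⁻¹ * ·) h1
  simp only [mul_add, ← Matrix.mul_assoc, mul_zero,
    Matrix.nonsing_inv_mul _ (isUnit_iff_ne_zero.2 h0), Matrix.one_mul] at h3
  exact eq_neg_of_add_eq_zero_right h3

end Wirtinger

/-! ### The divergence form of the polarised determinant -/

section Divergence

variable {n : ℕ}

/-- The derivative at `a` in the direction `b` of the cofactor matrix. -/
def mixedCofactor (a b : Matrix (Fin n) (Fin n) ℂ) : Matrix (Fin n) (Fin n) ℂ :=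
  a.det • ((a⁻¹ * b).trace • a⁻¹ - a⁻¹ * b * a⁻¹)

lemma mixedDet_eq_trace (a b e : Matrix (Fin n) (Fin n) ℂ) :
    mixedDet a b e = (mixedCofactor a b * e).trace := by
  simp only [mixedDet, mixedCofactor, Matrix.smul_mul, Matrix.sub_mul, Matrix.trace_smul,
    Matrix.trace_sub, smul_eq_mul]

lemma mixedDet_sum {ι : Type*} (s : Finset ι) (a b : Matrix (Fin n) (Fin n) ℂ)
    (e : ι → Matrix (Fin n) (Fin n) ℂ) :
    mixedDet a b (∑ k ∈ s, e k) = ∑ k ∈ s, mixedDet a b (e k) := by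
  simp only [mixedDet_eq_trace, Matrix.mul_sum, Matrix.trace_sum]

lemma contDiffAt_mixedCofactor {m : WithTop ℕ∞} {a b : Cn n → Matrix (Fin n) (Fin n) ℂ} {x : Cn n}
    (ha : ∀ i j, ContDiffAt ℝ m (fun y => a y i j) x)
    (hb : ∀ i j, ContDiffAt ℝ m (fun y => b y i j) x) (h0 : (a x).det ≠ 0) (i j : Fin n) :
    ContDiffAt ℝ m (fun y => mixedCofactor (a y) (b y) i j) x := by
  have hW := contDiffAt_inv ha h0
  have hWb := contDiffAt_mul hW hb
  exact (contDiffAt_det ha).mul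
    (((contDiffAt_trace hWb).mul (hW i j)).sub (contDiffAt_mul hWb hW i j))

/-- The contraction of closed forms: `∂ᵢ a_{p q̄} = ∂ₚ a_{i q̄}` moves the contracted index inside
a trace. -/
lemma sum_mul_closed {α : Fin n → Matrix (Fin n) (Fin n) ℂ}
    (hα : ∀ k i j, α k i j = α i k j) (X Y : Matrix (Fin n) (Fin n) ℂ) (j : Fin n) :
    ∑ i, (X * α i * Y) j i = ∑ p, X j p * (α p * Y).trace := by
  simp only [Matrix.mul_apply, Matrix.trace, Matrix.diag, Finset.sum_mul, Finset.mul_sum]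
  rw [Finset.sum_comm_cycle]
  refine Finset.sum_congr rfl fun p _ => Finset.sum_congr rfl fun i _ =>
    Finset.sum_congr rfl fun q _ => ?_
  rw [hα i p q]
  ring

/-- The columns of the mixed cofactor matrix of two closed Hermitian forms are divergence
free. -/
lemma sum_dzMatrix_mixedCofactor {a b : Cn n → Matrix (Fin n) (Fin n) ℂ} {x : Cn n}
    (ha : ∀ i j, ContDiffAt ℝ 1 (fun y => a y i j) x)
    (hb : ∀ i j, ContDiffAt ℝ 1 (fun y => b y i j) x) (h0 : (a x).det ≠ 0)
    (hac : ∀ k i j, dzMatrix k a x i j = dzMatrix i a x k j)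
    (hbc : ∀ k i j, dzMatrix k b x i j = dzMatrix i b x k j) (j : Fin n) :
    ∑ i, dzMatrix i (fun y => mixedCofactor (a y) (b y)) x j i = 0 := by
  have hW := contDiffAt_inv ha h0
  have hWb := contDiffAt_mul hW hb
  have hWbW := contDiffAt_mul hWb hW
  have D : ∀ {f : Cn n → ℂ}, ContDiffAt ℝ 1 f x → DifferentiableAt ℝ f x :=
    fun h => h.differentiableAt one_ne_zero
  have hadj : ∀ M : Matrix (Fin n) (Fin n) ℂ,
      ((a x).adjugate * M).trace = (a x).det * ((a x)⁻¹ * M).trace := fun M => by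
    have : (a x).adjugate = (a x).det • (a x)⁻¹ := by
      rw [Matrix.inv_def, smul_smul, Ring.mul_inverse_cancel _ (isUnit_iff_ne_zero.2 h0), one_smul]
    rw [this, Matrix.smul_mul, Matrix.trace_smul, smul_eq_mul]
  set W := (a x)⁻¹ with hWdef
  set d := (a x).det
  set B := b x
  have key : ∀ i, dzMatrix i (fun y => mixedCofactor (a y) (b y)) x =
      (d * (W * dzMatrix i a x).trace) • ((W * B).trace • W - W * B * W) +
      d • (((-(W * dzMatrix i a x * W) * B + W * dzMatrix i b x).trace) • W +
        (W * B).trace • (-(W * dzMatrix i a x * W)) -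
        ((-(W * dzMatrix i a x * W) * B + W * dzMatrix i b x) * W +
          W * B * (-(W * dzMatrix i a x * W)))) := fun i => by
    have e1 := dzMatrix_inv ha h0 i
    have e2 := dzMatrix_mul (fun i j => D (hW i j)) (fun i j => D (hb i j)) i
    have e3 := dzMatrix_mul (fun i j => D (hWb i j)) (fun i j => D (hW i j)) i
    have e4 := dz_trace (fun i j => D (hWb i j)) i
    have e5 := dz_det (fun i j => D (ha i j)) i
    rw [hadj] at e5
    rw [e1] at e2
    rw [e2, e1] at e3
    rw [e2] at e4
    rw [← e3, ← e4, ← e5, ← e1]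
    ext p q
    change dz i (fun y => (a y).det * (((a y)⁻¹ * b y).trace * (a y)⁻¹ p q -
      ((a y)⁻¹ * b y * (a y)⁻¹) p q)) x = _
    rw [dz_mul (D (contDiffAt_det ha)) (D (((contDiffAt_trace hWb).mul (hW p q)).sub (hWbW p q))),
      dz_sub (D ((contDiffAt_trace hWb).mul (hW p q))) (D (hWbW p q)),
      dz_mul (D (contDiffAt_trace hWb)) (D (hW p q))]
    rfl
  have s1 := sum_mul_closed hac W W j
  have s2 := sum_mul_closed hac W (W * B * W) j
  have s3 := sum_mul_closed hac (W * B * W) W j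
  have s4 := sum_mul_closed hbc W W j
  have t1 : ∀ i, (W * dzMatrix i a x).trace = (dzMatrix i a x * W).trace := fun i =>
    Matrix.trace_mul_comm _ _
  have t2 : ∀ i, (W * dzMatrix i b x).trace = (dzMatrix i b x * W).trace := fun i =>
    Matrix.trace_mul_comm _ _
  have t3 : ∀ i, (W * (dzMatrix i a x * (W * B))).trace =
      (dzMatrix i a x * (W * (B * W))).trace := fun i => by
    rw [Matrix.trace_mul_comm]
    simp only [Matrix.mul_assoc]
  have hi : ∀ i, dzMatrix i (fun y => mixedCofactor (a y) (b y)) x j i =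
      d * ((W * B).trace * (W j i * (dzMatrix i a x * W).trace - (W * dzMatrix i a x * W) j i) -
        ((W * B * W) j i * (dzMatrix i a x * W).trace - (W * B * W * dzMatrix i a x * W) j i) -
        (W j i * (dzMatrix i a x * (W * B * W)).trace -
          (W * dzMatrix i a x * (W * B * W)) j i) +
        (W j i * (dzMatrix i b x * W).trace - (W * dzMatrix i b x * W) j i)) := fun i => by
    rw [key i]
    simp only [Matrix.add_mul, Matrix.neg_mul, Matrix.mul_neg, Matrix.trace_add, Matrix.trace_neg,
      t1, t2, t3, Matrix.add_apply, Matrix.sub_apply, Matrix.smul_apply, Matrix.neg_apply,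
      smul_eq_mul, Matrix.mul_assoc]
    ring
  simp only [hi, ← Finset.mul_sum, Finset.sum_add_distrib, Finset.sum_sub_distrib, s1, s2, s3, s4]
  ring

/-- The polarised determinant of closed forms `a`, `b` and of `√-1∂∂̄η` is a divergence; here
`q` stands for the derivatives `∂̄ⱼη`. -/
lemma mixedDet_eq_divergence {a b : Cn n → Matrix (Fin n) (Fin n) ℂ} {q : Fin n → Cn n → ℂ}
    {x : Cn n} (ha : ∀ i j, ContDiffAt ℝ 1 (fun y => a y i j) x)
    (hb : ∀ i j, ContDiffAt ℝ 1 (fun y => b y i j) x) (h0 : (a x).det ≠ 0)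
    (hac : ∀ k i j, dzMatrix k a x i j = dzMatrix i a x k j)
    (hbc : ∀ k i j, dzMatrix k b x i j = dzMatrix i b x k j)
    (hq : ∀ j, ContDiffAt ℝ 1 (q j) x) :
    ∑ i, dz i (fun y => ∑ j, mixedCofactor (a y) (b y) j i * q j y) x =
      mixedDet (a x) (b x) (Matrix.of fun i j => dz i (q j) x) := by
  have hP := fun i j => (contDiffAt_mixedCofactor ha hb h0 i j).differentiableAt one_ne_zero
  have hq' := fun j => (hq j).differentiableAt one_ne_zero
  have h1 : ∀ i, dz i (fun y => ∑ j, mixedCofactor (a y) (b y) j i * q j y) x =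
      ∑ j, (dzMatrix i (fun y => mixedCofactor (a y) (b y)) x j i * q j x +
        mixedCofactor (a x) (b x) j i * dz i (q j) x) := fun i => by
    rw [dz_sum (F := fun j y => mixedCofactor (a y) (b y) j i * q j y) _
      fun j _ => (hP j i).mul (hq' j)]
    exact Finset.sum_congr rfl fun j _ => dz_mul (hP j i) (hq' j) i
  simp only [h1, Finset.sum_add_distrib]
  rw [Finset.sum_comm]
  simp only [← Finset.sum_mul, sum_dzMatrix_mixedCofactor ha hb h0 hac hbc, zero_mul,
    Finset.sum_const_zero, zero_add]
  rw [Finset.sum_comm, mixedDet_eq_trace]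
  rfl

end Divergence

section Local

variable {n : ℕ} {x : Cn n}

/-! ### Closed forms in local coordinates -/

lemma contDiffAt_fderiv_apply {E : Type*} [NormedAddCommGroup E] [NormedSpace ℝ E]
    {F : Cn n → E} (hF : ContDiffAt ℝ ∞ F x) (v : Cn n) :
    ContDiffAt ℝ ∞ (fun y => fderiv ℝ F y v) x :=
  (hF.fderiv_right (m := ∞) (by simp)).clm_apply contDiffAt_const

lemma contDiffAt_dz {F : Cn n → ℂ} (hF : ContDiffAt ℝ ∞ F x) (i : Fin n) :
    ContDiffAt ℝ ∞ (dz i F) x :=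
  contDiffAt_const.mul ((contDiffAt_fderiv_apply hF _).sub
    (contDiffAt_const.mul (contDiffAt_fderiv_apply hF _)))

lemma contDiffAt_dzbar {F : Cn n → ℂ} (hF : ContDiffAt ℝ ∞ F x) (i : Fin n) :
    ContDiffAt ℝ ∞ (dzbar i F) x :=
  contDiffAt_const.mul ((contDiffAt_fderiv_apply hF _).add
    (contDiffAt_const.mul (contDiffAt_fderiv_apply hF _)))

lemma contDiffAt_ofReal {f : Cn n → ℝ} (hf : ContDiffAt ℝ ∞ f x) :
    ContDiffAt ℝ ∞ (fun y => (f y : ℂ)) x :=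
  Complex.ofRealCLM.contDiff.contDiffAt.comp x hf

lemma contDiffAt_cxHessian {f : Cn n → ℝ} (hf : ContDiffAt ℝ ∞ f x) (i j : Fin n) :
    ContDiffAt ℝ ∞ (fun y => cxHessian f y i j) x :=
  contDiffAt_dz (contDiffAt_dzbar (contDiffAt_ofReal hf) j) i

lemma dz_comm {F : Cn n → ℂ} (hF : ContDiffAt ℝ 2 F x) (i k : Fin n) :
    dz k (dz i F) x = dz i (dz k F) x := by
  have hd : HasFDerivAt (fderiv ℝ F) (fderiv ℝ (fderiv ℝ F) x) x :=
    ((hF.fderiv_right (m := 1) (by norm_num)).differentiableAt (by simp)).hasFDerivAt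
  have hs : ∀ u v, fderiv ℝ (fderiv ℝ F) x u v = fderiv ℝ (fderiv ℝ F) x v u := fun u v =>
    (hF.isSymmSndFDerivAt (by simp)) u v
  have hw : ∀ w, HasFDerivAt (fun y => fderiv ℝ F y w) ((fderiv ℝ (fderiv ℝ F) x).flip w) x :=
    fun w => (ContinuousLinearMap.apply ℝ ℂ w).hasFDerivAt.comp x hd
  have h1 : ∀ i, fderiv ℝ (dz i F) x =
      (1 / 2 : ℂ) • ((fderiv ℝ (fderiv ℝ F) x).flip (Pi.single i 1) -
        Complex.I • (fderiv ℝ (fderiv ℝ F) x).flip (Pi.single i Complex.I)) := fun i =>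
    (((hw _).sub ((hw _).const_mul Complex.I)).const_mul (1 / 2 : ℂ)).fderiv
  rw [dz, h1, dz, h1]
  simp only [smul_apply, sub_apply, ContinuousLinearMap.flip_apply, smul_eq_mul]
  rw [hs (Pi.single k 1) (Pi.single i 1), hs (Pi.single k Complex.I) (Pi.single i 1),
    hs (Pi.single k 1) (Pi.single i Complex.I), hs (Pi.single k Complex.I)]
  ring

lemma dzMatrix_cxHessian_symm {f : Cn n → ℝ} (hf : ContDiffAt ℝ ∞ f x) (k i j : Fin n) :
    dzMatrix k (cxHessian f) x i j = dzMatrix i (cxHessian f) x k j :=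
  dz_comm ((contDiffAt_dzbar (contDiffAt_ofReal hf) j).of_le ENat.LEInfty.out) i k

end Local

section Pointwise

variable {n : ℕ} {M : Type*} [TopologicalSpace M] [ChartedSpace (Cn n) M]
  [IsManifold 𝓘(ℂ, Cn n) ω M] {c d p : M}

/-! ### Tensors at a point in different charts -/

/-- A bilinear form on `T_p M` as a form on the model space of the tangent spaces. -/
def modelForm (h : Tan n p →L[ℝ] Tan n p →L[ℝ] ℝ) : Cn n →L[ℝ] Cn n →L[ℝ] ℝ := h

/-- The matrix `h_{i j̄}` of a real bilinear form on `T_p M` in the coordinates of the chart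
at `c`. -/
def chartMatrix (h : Tan n p →L[ℝ] Tan n p →L[ℝ] ℝ) (c : M) : Matrix (Fin n) (Fin n) ℂ :=
  sesqMatrix (modelForm h) (coordVec n c p)

variable (n) in
/-- The change of components from the chart at `c` to the preferred chart at `p`, as an
endomorphism of `ℂⁿ`. -/
def transition (c p : M) : Cn n →L[ℝ] Cn n := coordVec n c p

variable (n) in
/-- The real Jacobian determinant of the change of coordinates from the chart at `c` to the
preferred chart at `p`. -/
def jacobian (c p : M) : ℝ := (transition n c p).det

omit [IsManifold 𝓘(ℂ, Cn n) ω M] in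
lemma chart_mem_extChartAt_source : p ∈ (extChartAt 𝓘(ℝ, Cn n) c).source ↔
    p ∈ (chartAt (Cn n) c).source := by
  rw [extChartAt_source]

lemma coordVec_comp (hc : p ∈ (chartAt (Cn n) c).source) (hd : p ∈ (chartAt (Cn n) d).source)
    (v : Cn n) : coordVec n d p (tangentCoordChange 𝓘(ℝ, Cn n) c d p v) = coordVec n c p v := by
  refine tangentCoordChange_comp (I := 𝓘(ℝ, Cn n)) ⟨⟨?_, ?_⟩, ?_⟩
  · rwa [chart_mem_extChartAt_source]
  · rwa [chart_mem_extChartAt_source]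
  · rw [chart_mem_extChartAt_source]; exact mem_chart_source _ p

lemma coordVec_left_inverse (hc : p ∈ (chartAt (Cn n) c).source) (v : Cn n) :
    tangentCoordChange 𝓘(ℝ, Cn n) p c p (coordVec n c p v) = v := by
  have h := tangentCoordChange_comp (I := 𝓘(ℝ, Cn n)) (w := c) (x := p) (y := c) (z := p) (v := v)
    ⟨⟨chart_mem_extChartAt_source.2 hc, chart_mem_extChartAt_source.2 (mem_chart_source _ p)⟩,
      chart_mem_extChartAt_source.2 hc⟩
  rw [tangentCoordChange_self (chart_mem_extChartAt_source.2 hc)] at h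
  exact h

lemma jacobian_eq_normSq (hc : p ∈ (chartAt (Cn n) c).source) :
    jacobian n c p = Complex.normSq (frameMatrix (transition n c p)).det :=
  det_eq_normSq_frameMatrix (transition n c p : Cn n →ₗ[ℝ] Cn n) fun v => coordVec_mulI hc v

lemma jacobian_ne_zero (hc : p ∈ (chartAt (Cn n) c).source) : jacobian n c p ≠ 0 := by
  intro h
  have h1 : ((tangentCoordChange 𝓘(ℝ, Cn n) p c p : Cn n →L[ℝ] Cn n) : Cn n →ₗ[ℝ] Cn n) ∘ₗ
      (transition n c p : Cn n →ₗ[ℝ] Cn n) = LinearMap.id :=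
    LinearMap.ext fun v => coordVec_left_inverse hc v
  have h2 := congrArg LinearMap.det h1
  rw [LinearMap.det_comp, LinearMap.det_id] at h2
  rw [show LinearMap.det (transition n c p : Cn n →ₗ[ℝ] Cn n) = 0 from h, mul_zero] at h2
  exact zero_ne_one h2

lemma frameMatrix_det_ne_zero (hc : p ∈ (chartAt (Cn n) c).source) :
    (frameMatrix (transition n c p)).det ≠ 0 := fun h =>
  jacobian_ne_zero hc (by rw [jacobian_eq_normSq hc, h, map_zero])

lemma jacobian_pos (hc : p ∈ (chartAt (Cn n) c).source) : 0 < jacobian n c p := by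
  refine lt_of_le_of_ne ?_ (jacobian_ne_zero hc).symm
  rw [jacobian_eq_normSq hc]
  exact Complex.normSq_nonneg _

lemma jacobian_mul (hc : p ∈ (chartAt (Cn n) c).source) (hd : p ∈ (chartAt (Cn n) d).source) :
    jacobian n c p = jacobian n d p * |(tangentCoordChange 𝓘(ℝ, Cn n) c d p).det| := by
  have h1 : (transition n c p : Cn n →ₗ[ℝ] Cn n) =
      (transition n d p : Cn n →ₗ[ℝ] Cn n) ∘ₗ
        ((tangentCoordChange 𝓘(ℝ, Cn n) c d p : Cn n →L[ℝ] Cn n) : Cn n →ₗ[ℝ] Cn n) :=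
    LinearMap.ext fun v => (coordVec_comp hc hd v).symm
  have h2 : jacobian n c p = jacobian n d p * (tangentCoordChange 𝓘(ℝ, Cn n) c d p).det := by
    rw [jacobian, ContinuousLinearMap.det, h1, LinearMap.det_comp]
    rfl
  rw [h2, abs_of_pos]
  have := jacobian_pos hc
  rw [h2] at this
  exact pos_of_mul_pos_right this (jacobian_pos hd).le

lemma chartMatrix_eq (h : Tan n p →L[ℝ] Tan n p →L[ℝ] ℝ) (c : M) :
    chartMatrix h c = (frameMatrix (transition n c p)).transpose *
      sesqMatrix (modelForm h) id * (frameMatrix (transition n c p)).map conj :=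
  sesqMatrix_eq _ _

lemma chartMatrix_apply (h : Tan n p →L[ℝ] Tan n p →L[ℝ] ℝ)
    (hc : p ∈ (chartAt (Cn n) c).source) (i j : Fin n) :
    chartMatrix h c i j = (1 / 4) *
      (((h (coordVec n c p (Pi.single i 1)) (coordVec n c p (Pi.single j 1)) +
        h (coordVec n c p (Pi.single i Complex.I)) (coordVec n c p (Pi.single j Complex.I)) : ℝ)
          : ℂ) +
        Complex.I * ((h (coordVec n c p (Pi.single i 1)) (coordVec n c p (Pi.single j Complex.I)) -
          h (coordVec n c p (Pi.single i Complex.I)) (coordVec n c p (Pi.single j 1)) : ℝ) :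
            ℂ)) := by
  rw [← mulI_single, ← mulI_single, coordVec_mulI hc, coordVec_mulI hc]
  rfl

lemma hermMatrix_eq (h : Tan n p →L[ℝ] Tan n p →L[ℝ] ℝ) : hermMatrix h = chartMatrix h p := by
  ext i j
  rw [chartMatrix_apply h (mem_chart_source _ p)]
  rfl

lemma mixedDet_chartMatrix (a b e : Tan n p →L[ℝ] Tan n p →L[ℝ] ℝ)
    (hc : p ∈ (chartAt (Cn n) c).source) :
    mixedDet (chartMatrix a c) (chartMatrix b c) (chartMatrix e c) =
      jacobian n c p * mixedDet (sesqMatrix (modelForm a) id) (sesqMatrix (modelForm b) id)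
        (sesqMatrix (modelForm e) id) := by
  rw [chartMatrix_eq, chartMatrix_eq, chartMatrix_eq,
    mixedDet_congr (frameMatrix_det_ne_zero hc), jacobian_eq_normSq hc]

/-- The symmetric form `√-1∂∂̄f(·,J·)`. -/
def iddbarMetric (f : M → ℝ) (p : M) : Tan n p →L[ℝ] Tan n p →L[ℝ] ℝ :=
  (ContinuousLinearMap.precomp ℝ (cxJ n p)).comp (iddbar n f p)

lemma chartMatrix_iddbarMetric {f : M → ℝ} (hf : ContMDiff 𝓘(ℝ, Cn n) 𝓘(ℝ) ∞ f)
    (hc : p ∈ (chartAt (Cn n) c).source) :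
    chartMatrix (iddbarMetric f p) c =
      cxHessian (f ∘ (chartAt (Cn n) c).symm) (chartAt (Cn n) c p) := by
  have h2 := contDiffAt_chart_two hf c ((chartAt (Cn n) c).map_source hc)
  have h : ∀ u v, iddbarMetric f p (coordVec n c p u) (coordVec n c p v) =
      (realHessian (f ∘ (chartAt (Cn n) c).symm) (chartAt (Cn n) c p) (mulI n u) (mulI n v) +
        realHessian (f ∘ (chartAt (Cn n) c).symm) (chartAt (Cn n) c p) u v) / 2 := fun u v => by
    change iddbar n f p (coordVec n c p u) (cxJ n p (coordVec n c p v)) = _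
    rw [← coordVec_mulI hc, iddbar_coordVec hf hc, hermForm_cxHessian h2, mulI_mulI, map_neg,
      sub_neg_eq_add]
  have hI : ∀ i : Fin n, mulI n (Pi.single i Complex.I) = -Pi.single i 1 := fun i => by
    rw [← mulI_single, mulI_mulI]
  ext i j
  rw [chartMatrix_apply _ hc, cxHessian_apply h2]
  simp only [h, mulI_single, hI, map_neg, neg_apply]
  push_cast
  ring

/-- The differential of a function at `p`. -/
def differential (f : M → ℝ) (p : M) : Cn n →L[ℝ] ℝ :=
  fderiv ℝ (f ∘ (chartAt (Cn n) p).symm) (chartAt (Cn n) p p)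

/-- The bilinear form `df ⊗ dη` at `p`. -/
def gradForm (f η : M → ℝ) (p : M) : Tan n p →L[ℝ] Tan n p →L[ℝ] ℝ :=
  (ContinuousLinearMap.mul ℝ ℝ).bilinearComp (differential f p) (differential η p)

lemma differential_coordVec {f : M → ℝ} (hf : ContMDiff 𝓘(ℝ, Cn n) 𝓘(ℝ) ∞ f)
    (hc : p ∈ (chartAt (Cn n) c).source) (v : Cn n) :
    differential f p (coordVec n c p v) =
      fderiv ℝ (f ∘ (chartAt (Cn n) c).symm) (chartAt (Cn n) c p) v := by
  set T := chartAt (Cn n) p ∘ (chartAt (Cn n) c).symm with hT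
  set x := chartAt (Cn n) c p with hx
  have hTx : T x = chartAt (Cn n) p p := by simp [hT, hx, hc]
  have hTd : DifferentiableAt ℝ T x :=
    ((contDiffAt_transition hc).restrict_scalars ℝ).differentiableAt (by simp)
  have hfp : DifferentiableAt ℝ (f ∘ (chartAt (Cn n) p).symm) (T x) := by
    rw [hTx]
    exact (contDiffAt_chart_two hf p (mem_chart_target _ p)).differentiableAt (by simp)
  have h2 : (f ∘ (chartAt (Cn n) p).symm) ∘ T =ᶠ[𝓝 x] f ∘ (chartAt (Cn n) c).symm := by
    have : ((chartAt (Cn n) c).symm ≫ₕ chartAt (Cn n) p).source ∈ 𝓝 x :=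
      ((chartAt (Cn n) c).symm ≫ₕ chartAt (Cn n) p).open_source.mem_nhds (by simp [hx, hc])
    filter_upwards [this] with y hy
    simp at hy
    simp [hT, hy.2]
  rw [← h2.fderiv_eq, fderiv_comp x hfp hTd, hTx, coordVec_eq]
  rfl

lemma chartMatrix_gradForm {f η : M → ℝ} (hf : ContMDiff 𝓘(ℝ, Cn n) 𝓘(ℝ) ∞ f)
    (hη : ContMDiff 𝓘(ℝ, Cn n) 𝓘(ℝ) ∞ η) (hc : p ∈ (chartAt (Cn n) c).source) :
    chartMatrix (gradForm f η p) c = Matrix.of fun i j =>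
      dz i (fun y => ((f ∘ (chartAt (Cn n) c).symm) y : ℂ)) (chartAt (Cn n) c p) *
        dzbar j (fun y => ((η ∘ (chartAt (Cn n) c).symm) y : ℂ)) (chartAt (Cn n) c p) := by
  have hr : ∀ {g : M → ℝ}, ContMDiff 𝓘(ℝ, Cn n) 𝓘(ℝ) ∞ g → ∀ v,
      fderiv ℝ (fun y => ((g ∘ (chartAt (Cn n) c).symm) y : ℂ)) (chartAt (Cn n) c p) v =
        (differential g p (coordVec n c p v) : ℂ) := fun {g} hg v => by
    have h1 := ((contDiffAt_chart_two hg c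
      ((chartAt (Cn n) c).map_source hc)).differentiableAt (by simp)).hasFDerivAt
    have h2 : HasFDerivAt (fun y => ((g ∘ (chartAt (Cn n) c).symm) y : ℂ))
        (Complex.ofRealCLM ∘L fderiv ℝ (g ∘ (chartAt (Cn n) c).symm) (chartAt (Cn n) c p))
        (chartAt (Cn n) c p) := Complex.ofRealCLM.hasFDerivAt.comp _ h1
    rw [differential_coordVec hg hc, h2.fderiv]
    rfl
  have hg : ∀ u v, gradForm f η p (coordVec n c p u) (coordVec n c p v) =
      differential f p (coordVec n c p u) * differential η p (coordVec n c p v) := fun u v => rfl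
  ext i j
  rw [chartMatrix_apply _ hc, Matrix.of_apply, dz, dzbar]
  simp only [hr hf, hr hη, hg]
  push_cast
  linear_combination ((differential f p (coordVec n c p (Pi.single i Complex.I)) : ℂ) *
    (differential η p (coordVec n c p (Pi.single j Complex.I)) : ℂ) / 4) * Complex.I_sq

end Pointwise

section Metric

variable {n : ℕ} {M : Type*} [TopologicalSpace M] [ChartedSpace (Cn n) M]
  [IsManifold 𝓘(ℂ, Cn n) ω M] {c p : M}

/-! ### Smoothness and closedness of the metric in local coordinates -/

/-- The coordinate vector fields of a chart are smooth. -/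
lemma contMDiffAt_coordVec (hc : p ∈ (chartAt (Cn n) c).source) (v : Cn n) :
    ContMDiffAt 𝓘(ℝ, Cn n) (𝓘(ℝ, Cn n).prod 𝓘(ℝ, Cn n)) ∞
      (fun q : M => Bundle.TotalSpace.mk' (Cn n) (E := fun p : M => Tan n p) q
        (coordVec n c q v)) p := by
  set e := trivializationAt (Cn n) (TangentSpace 𝓘(ℝ, Cn n) : M → Type _) c
  have hs : ∀ q ∈ (chartAt (Cn n) c).source, e.symm q v = coordVec n c q v := fun q hq => by
    have hb : q ∈ e.baseSet := hq
    rw [← Bundle.Trivialization.symmL_apply (R := ℝ) _ hb,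
      TangentBundle.symmL_trivializationAt_eq_core (I := 𝓘(ℝ, Cn n)) hq]
    rfl
  have h1 : ContMDiffOn 𝓘(ℝ, Cn n) (𝓘(ℝ, Cn n).prod 𝓘(ℝ, Cn n)) ∞
      (fun q : M => e.toOpenPartialHomeomorph.symm (q, v)) e.baseSet := by
    refine (e.contMDiffOn_symm (IB := 𝓘(ℝ, Cn n)) (n := ∞)).comp
      (contMDiffOn_id.prodMk contMDiffOn_const) fun q hq => ?_
    exact e.mem_target.2 hq
  have hp : e.baseSet ∈ 𝓝 p := e.open_baseSet.mem_nhds hc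
  refine (h1.contMDiffAt hp).congr_of_eventuallyEq ?_
  filter_upwards [hp] with q hq
  have hq' : q ∈ (chartAt (Cn n) c).source := hq
  rw [← hs q hq']
  exact e.mk_symm hq v

lemma contDiffAt_coordForm (g : RiemMetric n M) (v w : Cn n) {x : Cn n}
    (hx : x ∈ (chartAt (Cn n) c).target) : ContDiffAt ℝ ∞ (coordForm g.inner c v w) x := by
  have hc := (chartAt (Cn n) c).map_target hx
  have h1 := ContMDiffAt.clm_bundle_apply₂ (F₁ := Cn n) (F₂ := Cn n) (F₃ := ℝ)
    (E₁ := fun p : M => Tan n p) (E₂ := fun p : M => Tan n p) (E₃ := Bundle.Trivial M ℝ)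
    (g.contMDiff ((chartAt (Cn n) c).symm x)) (contMDiffAt_coordVec hc v)
    (contMDiffAt_coordVec hc w)
  have h2 : ContMDiffAt 𝓘(ℝ, Cn n) 𝓘(ℝ) ∞
      (fun q => g.inner q (coordVec n c q v) (coordVec n c q w)) ((chartAt (Cn n) c).symm x) := by
    rw [Bundle.contMDiffAt_totalSpace] at h1
    exact h1.2
  have h3 := (contMDiffOn_chart_symm (I := 𝓘(ℝ, Cn n)) (n := ∞) (x := c)).contMDiffAt
    ((chartAt (Cn n) c).open_target.mem_nhds hx)
  exact contMDiffAt_iff_contDiffAt.1 (h2.comp x h3)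

/-- Real form of `dω = 0`: the derivatives `∂ᵤ g(v, w)` of the components of a Kähler
metric satisfy a symmetry of type `∂ₖ g_{i j̄} = ∂ᵢ g_{k j̄}`. -/
lemma fderiv_coordForm_symm (K : KahlerStructure n M) {x : Cn n}
    (hx : x ∈ (chartAt (Cn n) c).target) (u v w : Cn n) :
    fderiv ℝ (coordForm K.metric.inner c v w) x u +
        fderiv ℝ (coordForm K.metric.inner c v (mulI n w)) x (mulI n u) =
      fderiv ℝ (coordForm K.metric.inner c u w) x v +
        fderiv ℝ (coordForm K.metric.inner c u (mulI n w)) x (mulI n v) := by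
  set D : Cn n → Cn n → Cn n → ℝ := fun u v w =>
    fderiv ℝ (coordForm K.metric.inner c v w) x u with hD
  have hnhds := (chartAt (Cn n) c).open_target.mem_nhds hx
  have hJ : ∀ y ∈ (chartAt (Cn n) c).target, ∀ v, coordVec n c ((chartAt (Cn n) c).symm y)
      (mulI n v) = cxJ n _ (coordVec n c ((chartAt (Cn n) c).symm y) v) := fun y hy v =>
    coordVec_mulI ((chartAt (Cn n) c).map_target hy) v
  have hclosed : ∀ u v w, D u (mulI n v) w + D v (mulI n w) u + D w (mulI n u) v = 0 := by
    intro u v w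
    have h := K.closed c x hx u v w
    have he : ∀ v w, coordForm (fun p => (K.metric.inner p).comp (cxJ n p)) c v w =ᶠ[𝓝 x]
        coordForm K.metric.inner c (mulI n v) w := fun v w => by
      filter_upwards [hnhds] with y hy
      simp only [coordForm, hJ y hy]
      rfl
    rwa [(he v w).fderiv_eq, (he w u).fderiv_eq, (he u v).fderiv_eq] at h
  have hsymm : ∀ u v w, D u v w = D u w v := fun u v w => by
    have : coordForm K.metric.inner c v w = coordForm K.metric.inner c w v :=
      funext fun y => K.metric.symm _ _ _
    simp only [hD, this]
  have hneg : ∀ u v w, D u (-v) w = -D u v w := fun u v w => by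
    have : coordForm K.metric.inner c (-v) w = -coordForm K.metric.inner c v w := by
      funext y
      simp only [coordForm, Pi.neg_apply, map_neg, neg_apply]
    simp only [hD, this, fderiv_neg, neg_apply]
  have hinv : ∀ u v w, D u (mulI n v) (mulI n w) = D u v w := fun u v w => by
    have : coordForm K.metric.inner c (mulI n v) (mulI n w) =ᶠ[𝓝 x]
        coordForm K.metric.inner c v w := by
      filter_upwards [hnhds] with y hy
      simp only [coordForm, hJ y hy]
      exact K.hermitian _ _ _
    simp only [hD, this.fderiv_eq]
  have hskew : ∀ u v w, D u (mulI n v) w = -D u v (mulI n w) := fun u v w => by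
    rw [← hinv u v (mulI n w), mulI_mulI, hsymm u _ (-w), hneg, neg_neg, hsymm]
  -- The sum of `dω(Ju, v, w) = 0` and `dω(u, Jv, w) = 0`.
  have e1 := hclosed (mulI n u) v w
  have e2 := hclosed u (mulI n v) w
  rw [mulI_mulI, hneg] at e1 e2
  rw [hskew (mulI n u)] at e1
  rw [hinv] at e1
  rw [hsymm (mulI n v) (mulI n w) u, hsymm w (mulI n u), hinv] at e2
  rw [hsymm v w u] at e1
  change D u v w + D (mulI n u) v (mulI n w) = D v u w + D (mulI n v) u (mulI n w)
  have := hsymm w u v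
  linarith

/-- The matrix of `g_φ` as a function of the coordinates in the chart at `c`. -/
def metricMatrix (K : KahlerStructure n M) (φ : Smooth n M) (c : M) (x : Cn n) :
    Matrix (Fin n) (Fin n) ℂ :=
  chartMatrix (metricTensor K φ ((chartAt (Cn n) c).symm x)) c

lemma chartMatrix_add (h k : Tan n p →L[ℝ] Tan n p →L[ℝ] ℝ)
    (hc : p ∈ (chartAt (Cn n) c).source) :
    chartMatrix (h + k) c = chartMatrix h c + chartMatrix k c := by
  ext i j
  rw [Matrix.add_apply, chartMatrix_apply _ hc, chartMatrix_apply _ hc, chartMatrix_apply _ hc]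
  simp only [add_apply]
  push_cast
  ring

lemma metricMatrix_apply (K : KahlerStructure n M) (φ : Smooth n M) {x : Cn n}
    (hx : x ∈ (chartAt (Cn n) c).target) (i j : Fin n) :
    metricMatrix K φ c x i j =
      (1 / 2) * ((coordForm K.metric.inner c (Pi.single i 1) (Pi.single j 1) x : ℂ) + Complex.I *
        (coordForm K.metric.inner c (Pi.single i 1) (mulI n (Pi.single j 1)) x : ℂ)) +
      cxHessian (φ ∘ (chartAt (Cn n) c).symm) x i j := by
  have hc := (chartAt (Cn n) c).map_target hx
  have h1 : metricTensor K φ ((chartAt (Cn n) c).symm x) =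
      K.metric.inner _ + iddbarMetric φ _ := metricTensor_eq K φ _
  rw [metricMatrix, h1, chartMatrix_add _ _ hc, Matrix.add_apply,
    chartMatrix_iddbarMetric φ.contMDiff hc, (chartAt (Cn n) c).right_inv hx]
  congr 1
  have h2 : chartMatrix (K.metric.inner ((chartAt (Cn n) c).symm x)) c i j =
      sesq (modelForm (K.metric.inner ((chartAt (Cn n) c).symm x)))
        (transition n c ((chartAt (Cn n) c).symm x) (Pi.single i 1))
        (transition n c ((chartAt (Cn n) c).symm x) (Pi.single j 1)) := rfl
  have h3 : transition n c ((chartAt (Cn n) c).symm x) (mulI n (Pi.single j 1)) =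
      mulI n (transition n c ((chartAt (Cn n) c).symm x) (Pi.single j 1)) := coordVec_mulI hc _
  rw [h2, sesq_of_invariant (h := modelForm (K.metric.inner _)) (K.hermitian _), ← h3]
  rfl

lemma contDiffAt_metricMatrix (K : KahlerStructure n M) (φ : Smooth n M) {x : Cn n}
    (hx : x ∈ (chartAt (Cn n) c).target) (i j : Fin n) :
    ContDiffAt ℝ ∞ (fun y => metricMatrix K φ c y i j) x := by
  have h1 := (contDiffAt_const (c := (1 / 2 : ℂ))).mul
    ((contDiffAt_ofReal (contDiffAt_coordForm K.metric (Pi.single i 1) (Pi.single j 1) hx)).add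
      ((contDiffAt_const (c := Complex.I)).mul (contDiffAt_ofReal
        (contDiffAt_coordForm K.metric (Pi.single i 1) (mulI n (Pi.single j 1)) hx))))
  have h2 := contDiffAt_cxHessian (contDiffAt_chart φ.contMDiff c hx) i j
  refine (h1.add h2).congr_of_eventuallyEq ?_
  filter_upwards [(chartAt (Cn n) c).open_target.mem_nhds hx] with y hy
  exact metricMatrix_apply K φ hy i j

lemma dz_add_I_mul {f g : Cn n → ℝ} {x : Cn n} (hf : DifferentiableAt ℝ f x)
    (hg : DifferentiableAt ℝ g x) (k : Fin n) :
    dz k (fun y => (1 / 2) * ((f y : ℂ) + Complex.I * (g y : ℂ))) x = (1 / 4) *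
      (((fderiv ℝ f x (Pi.single k 1) + fderiv ℝ g x (mulI n (Pi.single k 1)) : ℝ) : ℂ) +
        Complex.I * ((fderiv ℝ g x (Pi.single k 1) -
          fderiv ℝ f x (mulI n (Pi.single k 1)) : ℝ) : ℂ)) := by
  have hr : ∀ {f : Cn n → ℝ}, DifferentiableAt ℝ f x →
      HasFDerivAt (fun y => (f y : ℂ)) (Complex.ofRealCLM ∘L fderiv ℝ f x) x := fun h =>
    Complex.ofRealCLM.hasFDerivAt.comp x h.hasFDerivAt
  have hd : HasFDerivAt (fun y => (1 / 2) * ((f y : ℂ) + Complex.I * (g y : ℂ)))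
      ((1 / 2 : ℂ) • (Complex.ofRealCLM ∘L fderiv ℝ f x +
        Complex.I • (Complex.ofRealCLM ∘L fderiv ℝ g x))) x :=
    ((hr hf).add ((hr hg).const_mul Complex.I)).const_mul (1 / 2 : ℂ)
  rw [dz, hd.fderiv, mulI_single]
  simp only [smul_apply, add_apply, ContinuousLinearMap.comp_apply, Complex.ofRealCLM_apply,
    smul_eq_mul]
  push_cast
  linear_combination (-(fderiv ℝ g x (Pi.single k Complex.I) : ℂ) / 4) * Complex.I_sq

/-- The Kähler condition `∂g_{i j̄}/∂zᵏ = ∂g_{k j̄}/∂zⁱ`. -/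
lemma dzMatrix_metricMatrix_symm (K : KahlerStructure n M) (φ : Smooth n M) {x : Cn n}
    (hx : x ∈ (chartAt (Cn n) c).target) (k i j : Fin n) :
    dzMatrix k (metricMatrix K φ c) x i j = dzMatrix i (metricMatrix K φ c) x k j := by
  have hG : ∀ v w, DifferentiableAt ℝ (coordForm K.metric.inner c v w) x := fun v w =>
    (contDiffAt_coordForm K.metric v w hx).differentiableAt (by simp)
  have hneg : ∀ u v w, fderiv ℝ (coordForm K.metric.inner c v (-w)) x u =
      -fderiv ℝ (coordForm K.metric.inner c v w) x u := fun u v w => by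
    have : coordForm K.metric.inner c v (-w) = -coordForm K.metric.inner c v w := by
      funext y
      simp only [coordForm, Pi.neg_apply, map_neg]
    rw [this, fderiv_neg, neg_apply]
  have hφ := contDiffAt_chart φ.contMDiff c hx
  have h1 : ∀ k i, dzMatrix k (metricMatrix K φ c) x i j = (1 / 4) *
      (((fderiv ℝ (coordForm K.metric.inner c (Pi.single i 1) (Pi.single j 1)) x (Pi.single k 1) +
        fderiv ℝ (coordForm K.metric.inner c (Pi.single i 1) (mulI n (Pi.single j 1))) x
          (mulI n (Pi.single k 1)) : ℝ) : ℂ) + Complex.I *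
      ((fderiv ℝ (coordForm K.metric.inner c (Pi.single i 1) (mulI n (Pi.single j 1))) x
          (Pi.single k 1) -
        fderiv ℝ (coordForm K.metric.inner c (Pi.single i 1) (Pi.single j 1)) x
          (mulI n (Pi.single k 1)) : ℝ) : ℂ)) +
      dzMatrix k (cxHessian (φ ∘ (chartAt (Cn n) c).symm)) x i j := fun k i => by
    have h2 : (fun y => metricMatrix K φ c y i j) =ᶠ[𝓝 x] fun y =>
        (1 / 2) * ((coordForm K.metric.inner c (Pi.single i 1) (Pi.single j 1) y : ℂ) +
          Complex.I *
          (coordForm K.metric.inner c (Pi.single i 1) (mulI n (Pi.single j 1)) y : ℂ)) +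
        cxHessian (φ ∘ (chartAt (Cn n) c).symm) y i j := by
      filter_upwards [(chartAt (Cn n) c).open_target.mem_nhds hx] with y hy
      exact metricMatrix_apply K φ hy i j
    have hd : ∀ v w, DifferentiableAt ℝ (fun y => (coordForm K.metric.inner c v w y : ℂ)) x :=
      fun v w => (contDiffAt_ofReal (contDiffAt_coordForm K.metric v w hx)).differentiableAt
        (by simp)
    have hd' : DifferentiableAt ℝ (fun y => (1 / 2) *
        ((coordForm K.metric.inner c (Pi.single i 1) (Pi.single j 1) y : ℂ) + Complex.I *
          (coordForm K.metric.inner c (Pi.single i 1) (mulI n (Pi.single j 1)) y : ℂ))) x :=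
      ((hd _ _).add ((hd _ _).const_mul _)).const_mul _
    rw [dzMatrix, Matrix.of_apply, dz_congr h2, dz_add hd'
      ((contDiffAt_cxHessian hφ i j).differentiableAt (by simp)), dz_add_I_mul (hG _ _) (hG _ _)]
    rfl
  have e1 := fderiv_coordForm_symm K hx (Pi.single k 1) (Pi.single i 1) (Pi.single j 1)
  have e2 := fderiv_coordForm_symm K hx (Pi.single k 1) (Pi.single i 1) (mulI n (Pi.single j 1))
  simp only [mulI_mulI, hneg, ← sub_eq_add_neg] at e2
  rw [h1, h1, e1, e2, dzMatrix_cxHessian_symm hφ]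

end Metric

/-! ### Integration in a chart -/

section Euclidean

variable {n : ℕ} {U Z : Set (Cn n)}

lemma integrableOn_of_compact {F : Cn n → ℂ} (hU : IsOpen U) (hZ : IsCompact Z) (hZU : Z ⊆ U)
    (hF : ContinuousOn F U) (h0 : ∀ x ∈ U, x ∉ Z → F x = 0) : IntegrableOn F U :=
  ((hF.mono hZU).integrableOn_compact hZ).of_forall_sdiff_eq_zero hU.measurableSet
    fun x hx => h0 x hx.1 hx.2

/-- The divergence theorem for functions with compact support in an open set. -/
lemma setIntegral_fderiv_eq_zero {F : Cn n → ℂ} (hU : IsOpen U) (hZ : IsCompact Z) (hZU : Z ⊆ U)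
    (hF : ∀ x ∈ U, ContDiffAt ℝ 1 F x) (h0 : ∀ x ∈ U, x ∉ Z → F x = 0) (v : Cn n) :
    ∫ x in U, fderiv ℝ F x v = 0 := by
  set G := U.indicator F with hG
  have hGU : ∀ x ∈ U, G =ᶠ[𝓝 x] F := fun x hx => by
    filter_upwards [hU.mem_nhds hx] with y hy using Set.indicator_of_mem hy F
  have hGZ : ∀ x ∉ Z, G =ᶠ[𝓝 x] fun _ => 0 := fun x hx => by
    filter_upwards [hZ.isClosed.isOpen_compl.mem_nhds hx] with y hy
    by_cases hyU : y ∈ U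
    · rw [hG, Set.indicator_of_mem hyU, h0 y hyU hy]
    · rw [hG, Set.indicator_of_notMem hyU]
  have hGd : ContDiff ℝ 1 G := contDiff_iff_contDiffAt.2 fun x => by
    by_cases hx : x ∈ U
    · exact (hF x hx).congr_of_eventuallyEq (hGU x hx)
    · exact contDiffAt_const.congr_of_eventuallyEq (hGZ x fun h => hx (hZU h))
  have hGc : HasCompactSupport G := HasCompactSupport.intro hZ fun x hx => (hGZ x hx).self_of_nhds
  have h1 : ∫ x in U, fderiv ℝ F x v = ∫ x, fderiv ℝ G x v := by
    rw [← setIntegral_eq_integral_of_forall_compl_eq_zero (s := U)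
      (f := fun x => fderiv ℝ G x v)]
    · exact setIntegral_congr_fun hU.measurableSet fun x hx => by
        rw [(hGU x hx).fderiv_eq]
    · intro x hx
      rw [(hGZ x fun h => hx (hZU h)).fderiv_eq]
      simp
  have hG' : Integrable fun x => fderiv ℝ G x v :=
    ((hGd.continuous_fderiv one_ne_zero).clm_apply continuous_const).integrable_of_hasCompactSupport
      (hGc.fderiv_apply ℝ v)
  -- Integration by parts against the constant function `1`.
  have h2 := integral_mul_fderiv_eq_neg_fderiv_mul_of_integrable (μ := volume) (𝕜 := ℂ)
    (f := fun _ : Cn n => (1 : ℂ)) (g := G) (v := v) (by simp) (by simpa using hG')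
    (by simpa using hGd.continuous.integrable_of_hasCompactSupport hGc)
    (fun x _ => differentiableAt_const _) (fun x _ => hGd.differentiable one_ne_zero x)
  rw [h1]
  simpa using h2

lemma setIntegral_dz_eq_zero {F : Cn n → ℂ} (hU : IsOpen U) (hZ : IsCompact Z) (hZU : Z ⊆ U)
    (hF : ∀ x ∈ U, ContDiffAt ℝ 1 F x) (h0 : ∀ x ∈ U, x ∉ Z → F x = 0) (i : Fin n) :
    IntegrableOn (dz i F) U ∧ ∫ x in U, dz i F x = 0 := by
  have hi : ∀ v, IntegrableOn (fun x => fderiv ℝ F x v) U := fun v => by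
    refine integrableOn_of_compact hU hZ hZU (fun x hx => ?_) fun x hx hxZ => ?_
    · exact (((hF x hx).fderiv_right (m := 0) (by simp)).continuousAt.clm_apply
        continuousAt_const).continuousWithinAt
    · have : F =ᶠ[𝓝 x] fun _ => 0 := by
        filter_upwards [(hU.inter hZ.isClosed.isOpen_compl).mem_nhds ⟨hx, hxZ⟩] with y hy
        exact h0 y hy.1 hy.2
      rw [this.fderiv_eq]
      simp
  refine ⟨((hi _).sub ((hi _).const_mul _)).const_mul _, ?_⟩
  simp only [dz]
  rw [integral_const_mul, integral_sub (hi _) ((hi _).const_mul _), integral_const_mul,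
    setIntegral_fderiv_eq_zero hU hZ hZU hF h0, setIntegral_fderiv_eq_zero hU hZ hZU hF h0]
  simp

end Euclidean

section Charts

variable {n : ℕ} {M : Type*} [TopologicalSpace M] [ChartedSpace (Cn n) M]
  [IsManifold 𝓘(ℂ, Cn n) ω M] {c d p : M}

lemma hasFDerivAt_chart_comp (hc : p ∈ (chartAt (Cn n) c).source)
    (hd : p ∈ (chartAt (Cn n) d).source) :
    HasFDerivAt (chartAt (Cn n) d ∘ (chartAt (Cn n) c).symm)
      (tangentCoordChange 𝓘(ℝ, Cn n) c d p) (chartAt (Cn n) c p) := by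
  have h := hasFDerivWithinAt_tangentCoordChange (I := 𝓘(ℝ, Cn n)) (x := c) (y := d) (z := p)
    ⟨chart_mem_extChartAt_source.2 hc, chart_mem_extChartAt_source.2 hd⟩
  simp only [modelWithCornersSelf_coe, Set.range_id, hasFDerivWithinAt_univ] at h
  exact h

variable (n) in
/-- The integral over the domain of the chart at `c` of the density that is given at `p`, in the
coordinates of the preferred chart at `p`, by `ψ p`. -/
def chartIntegral (c : M) (ψ : M → ℂ) : ℂ :=
  ∫ x in (chartAt (Cn n) c).target,
    (jacobian n c ((chartAt (Cn n) c).symm x) : ℂ) * ψ ((chartAt (Cn n) c).symm x)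

/-- The integral of a density does not depend on the chart. -/
lemma chartIntegral_eq (ψ : M → ℂ) (hψ : ∀ p, ψ p ≠ 0 →
    p ∈ (chartAt (Cn n) c).source ∧ p ∈ (chartAt (Cn n) d).source) :
    chartIntegral n c ψ = chartIntegral n d ψ := by
  set T := (chartAt (Cn n) c).symm ≫ₕ chartAt (Cn n) d with hT
  have hTs : ∀ x, x ∈ T.source ↔ x ∈ (chartAt (Cn n) c).target ∧
      (chartAt (Cn n) c).symm x ∈ (chartAt (Cn n) d).source := fun x => by
    simp [hT]
  have hTt : ∀ y, y ∈ T.target ↔ y ∈ (chartAt (Cn n) d).target ∧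
      (chartAt (Cn n) d).symm y ∈ (chartAt (Cn n) c).source := fun x => by
    simp [hT]
  have h1 : chartIntegral n c ψ = ∫ x in T.source,
      (jacobian n c ((chartAt (Cn n) c).symm x) : ℂ) * ψ ((chartAt (Cn n) c).symm x) := by
    refine setIntegral_eq_of_subset_of_forall_sdiff_eq_zero
      (chartAt (Cn n) c).open_target.measurableSet (fun x hx => ((hTs x).1 hx).1) fun x hx => ?_
    by_contra h
    exact hx.2 ((hTs x).2 ⟨hx.1, (hψ _ (right_ne_zero_of_mul h)).2⟩)
  have h2 : chartIntegral n d ψ = ∫ x in T.target,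
      (jacobian n d ((chartAt (Cn n) d).symm x) : ℂ) * ψ ((chartAt (Cn n) d).symm x) := by
    refine setIntegral_eq_of_subset_of_forall_sdiff_eq_zero
      (chartAt (Cn n) d).open_target.measurableSet (fun x hx => ((hTt x).1 hx).1) fun x hx => ?_
    by_contra h
    exact hx.2 ((hTt x).2 ⟨hx.1, (hψ _ (right_ne_zero_of_mul h)).1⟩)
  rw [h1, h2, integral_target_eq_integral_abs_det_fderiv_smul volume
    (f' := fun x => tangentCoordChange 𝓘(ℝ, Cn n) c d ((chartAt (Cn n) c).symm x))]
  · refine setIntegral_congr_fun T.open_source.measurableSet fun x hx => ?_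
    have hx' := (hTs x).1 hx
    have hTx : (chartAt (Cn n) d).symm (T x) = (chartAt (Cn n) c).symm x := by
      simp [hT, hx'.2]
    change _ = |_| • _
    simp only [hTx]
    rw [jacobian_mul ((chartAt (Cn n) c).map_target hx'.1) hx'.2, Complex.real_smul]
    push_cast
    ring
  · intro x hx
    have hx' := (hTs x).1 hx
    have := hasFDerivAt_chart_comp ((chartAt (Cn n) c).map_target hx'.1) hx'.2
    rwa [(chartAt (Cn n) c).right_inv hx'.1] at this

end Charts

/-! ### Integration by parts on a compact Kähler manifold -/

section Stokes

variable {n : ℕ} {M : Type*} [TopologicalSpace M] [ChartedSpace (Cn n) M]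
  [IsManifold 𝓘(ℂ, Cn n) ω M] {c d p : M}

/-- The matrix of `g_φ` at `p` in the preferred chart. -/
def metricAt (K : KahlerStructure n M) (φ : Smooth n M) (p : M) : Matrix (Fin n) (Fin n) ℂ :=
  sesqMatrix (modelForm (metricTensor K φ p)) id

/-- The complex Hessian of `ν` at `p` in the preferred chart. -/
def hessianAt (ν : Smooth n M) (p : M) : Matrix (Fin n) (Fin n) ℂ :=
  sesqMatrix (modelForm (iddbarMetric ν p)) id

/-- The density whose coefficient is the polarised determinant of `g_φ`, `√-1∂∂̄ν` and `e`, in the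
preferred chart at each point. -/
def mixedDensity (K : KahlerStructure n M) (φ ν : Smooth n M)
    (e : ∀ p : M, Tan n p →L[ℝ] Tan n p →L[ℝ] ℝ) (p : M) : ℂ :=
  mixedDet (metricAt K φ p) (hessianAt ν p) (sesqMatrix (modelForm (e p)) id)

lemma jacobian_mul_mixedDensity (K : KahlerStructure n M) (φ ν : Smooth n M)
    (e : ∀ p : M, Tan n p →L[ℝ] Tan n p →L[ℝ] ℝ) {x : Cn n}
    (hx : x ∈ (chartAt (Cn n) c).target) :
    (jacobian n c ((chartAt (Cn n) c).symm x) : ℂ) *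
        mixedDensity K φ ν e ((chartAt (Cn n) c).symm x) =
      mixedDet (metricMatrix K φ c x) (cxHessian (ν ∘ (chartAt (Cn n) c).symm) x)
        (chartMatrix (e ((chartAt (Cn n) c).symm x)) c) := by
  have hc := (chartAt (Cn n) c).map_target hx
  rw [mixedDensity, metricAt, hessianAt, ← mixedDet_chartMatrix _ _ _ hc,
    chartMatrix_iddbarMetric ν.contMDiff hc, (chartAt (Cn n) c).right_inv hx]
  rfl

open scoped ComplexOrder in
lemma posDef_metricAt (K : KahlerStructure n M) (φ : kahlerPotentials K) (p : M) :
    (metricAt K φ p).PosDef :=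
  posDef_sesqMatrix (metricTensor_symm K φ p) (φ.2 p)

open scoped ComplexOrder in
lemma det_metricAt_pos (K : KahlerStructure n M) (φ : kahlerPotentials K) (p : M) :
    0 < (metricAt K φ p).det.re :=
  (Complex.pos_iff.1 (posDef_metricAt K φ p).det_pos).1

lemma det_metricAt_ne_zero (K : KahlerStructure n M) (φ : kahlerPotentials K) (p : M) :
    (metricAt K φ p).det ≠ 0 := fun h => by
  have := det_metricAt_pos K φ p
  rw [h] at this
  exact lt_irrefl _ this

lemma det_chartMatrix_metricTensor_ne_zero (K : KahlerStructure n M) (φ : kahlerPotentials K)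
    (hc : p ∈ (chartAt (Cn n) c).source) : (chartMatrix (metricTensor K φ p) c).det ≠ 0 := by
  rw [chartMatrix_eq, det_congr]
  refine mul_ne_zero ?_ ?_
  · simpa using frameMatrix_det_ne_zero hc
  · exact det_metricAt_ne_zero K φ p

lemma contDiffAt_mixedDet {x : Cn n} {m : WithTop ℕ∞} {a b e : Cn n → Matrix (Fin n) (Fin n) ℂ}
    (ha : ∀ i j, ContDiffAt ℝ m (fun y => a y i j) x)
    (hb : ∀ i j, ContDiffAt ℝ m (fun y => b y i j) x)
    (he : ∀ i j, ContDiffAt ℝ m (fun y => e y i j) x) (h0 : (a x).det ≠ 0) :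
    ContDiffAt ℝ m (fun y => mixedDet (a y) (b y) (e y)) x := by
  simp only [mixedDet_eq_trace]
  exact contDiffAt_trace (contDiffAt_mul (contDiffAt_mixedCofactor ha hb h0) he)

omit [IsManifold 𝓘(ℂ, Cn n) ω M] in
lemma isCompact_chart_image [CompactSpace M] {f : M → ℝ}
    (hf : tsupport f ⊆ (chartAt (Cn n) c).source) :
    IsCompact (chartAt (Cn n) c '' tsupport f) :=
  (isClosed_tsupport f).isCompact.image_of_continuousOn ((chartAt (Cn n) c).continuousOn.mono hf)

omit [IsManifold 𝓘(ℂ, Cn n) ω M] in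
lemma chart_image_subset {f : M → ℝ} (hf : tsupport f ⊆ (chartAt (Cn n) c).source) :
    chartAt (Cn n) c '' tsupport f ⊆ (chartAt (Cn n) c).target := by
  rintro _ ⟨p, hp, rfl⟩
  exact (chartAt (Cn n) c).map_source (hf hp)

omit [IsManifold 𝓘(ℂ, Cn n) ω M] in
lemma notMem_tsupport {f : M → ℝ} {x : Cn n} (hx : x ∈ (chartAt (Cn n) c).target)
    (hxf : x ∉ chartAt (Cn n) c '' tsupport f) : (chartAt (Cn n) c).symm x ∉ tsupport f :=
  fun h => hxf ⟨_, h, (chartAt (Cn n) c).right_inv hx⟩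

omit [IsManifold 𝓘(ℂ, Cn n) ω M] in
lemma integrableOn_chart [CompactSpace M] {f : M → ℝ}
    (hf : tsupport f ⊆ (chartAt (Cn n) c).source) {G : Cn n → ℂ}
    (hG : ContinuousOn G (chartAt (Cn n) c).target)
    (h0 : ∀ x ∈ (chartAt (Cn n) c).target, (chartAt (Cn n) c).symm x ∉ tsupport f → G x = 0) :
    IntegrableOn G (chartAt (Cn n) c).target :=
  integrableOn_of_compact (chartAt (Cn n) c).open_target (isCompact_chart_image hf)
    (chart_image_subset hf) hG fun x hx hxf => h0 x hx (notMem_tsupport hx hxf)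

omit [IsManifold 𝓘(ℂ, Cn n) ω M] in
lemma differential_eq_zero {f : M → ℝ} (hp : p ∉ tsupport f) : differential (n := n) f p = 0 := by
  have h1 : f =ᶠ[𝓝 p] 0 := notMem_tsupport_iff_eventuallyEq.1 hp
  have h2 : Filter.Tendsto (chartAt (Cn n) p).symm (𝓝 (chartAt (Cn n) p p)) (𝓝 p) := by
    have := (chartAt (Cn n) p).continuousAt_symm (mem_chart_target (Cn n) p)
    rwa [ContinuousAt, (chartAt (Cn n) p).left_inv (mem_chart_source _ p)] at this
  have h3 : f ∘ (chartAt (Cn n) p).symm =ᶠ[𝓝 (chartAt (Cn n) p p)] fun _ => (0 : ℝ) :=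
    h2.eventually h1
  rw [differential, h3.fderiv_eq]
  simp

lemma mixedDet_zero (a b : Matrix (Fin n) (Fin n) ℂ) : mixedDet a b 0 = 0 := by
  simp [mixedDet]

omit [IsManifold 𝓘(ℂ, Cn n) ω M] in
lemma sesqMatrix_sum_gradForm {ι : Type*} (s : Finset ι) (f : ι → M → ℝ) (η : M → ℝ) (p : M) :
    ∑ i ∈ s, sesqMatrix (modelForm (gradForm (f i) η p)) id =
      sesqMatrix ((ContinuousLinearMap.mul ℝ ℝ).bilinearComp
        (∑ i ∈ s, differential (n := n) (f i) p) (differential η p)) id := by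
  ext j k
  rw [Matrix.sum_apply]
  have h : ∀ i u v, modelForm (gradForm (n := n) (f i) η p) u v =
      differential (f i) p u * differential η p v := fun i u v => rfl
  simp only [sesqMatrix, Matrix.of_apply, sesq, h, ContinuousLinearMap.bilinearComp_apply,
    ContinuousLinearMap.mul_apply', sum_apply, Finset.sum_mul]
  push_cast
  simp only [← Finset.mul_sum, Finset.sum_add_distrib, Finset.sum_sub_distrib]

lemma mixedDensity_gradForm_eq_zero (K : KahlerStructure n M) (φ ν η : Smooth n M) {f : M → ℝ}
    (hp : p ∉ tsupport f) : mixedDensity K φ ν (gradForm f η) p = 0 := by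
  have h := sesqMatrix_sum_gradForm (n := n) {()} (fun _ => f) η p
  rw [Finset.sum_singleton, Finset.sum_singleton, differential_eq_zero hp] at h
  have h1 : sesqMatrix ((ContinuousLinearMap.mul ℝ ℝ).bilinearComp (0 : Cn n →L[ℝ] ℝ)
      (differential η p)) id = 0 := by
    ext i j
    simp [sesqMatrix, sesq]
  rw [mixedDensity, h, h1, mixedDet_zero]

lemma sum_mixedDensity_gradForm {ι : Type*} (s : Finset ι) (K : KahlerStructure n M)
    (φ ν η : Smooth n M) (f : ι → Smooth n M) (hs : ∀ p, ∑ i ∈ s, f i p = 1) (p : M) :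
    ∑ i ∈ s, mixedDensity K φ ν (gradForm (f i) η) p = 0 := by
  have h1 : ∑ i ∈ s, differential (n := n) (f i) p = 0 := by
    have hd : ∀ i ∈ s, DifferentiableAt ℝ (f i ∘ (chartAt (Cn n) p).symm) (chartAt (Cn n) p p) :=
      fun i _ => (contDiffAt_chart_two (f i).contMDiff p (mem_chart_target _ p)).differentiableAt
        (by simp)
    have h2 := fderiv_fun_sum (𝕜 := ℝ) hd
    have h3 : (fun y => ∑ i ∈ s, (f i ∘ (chartAt (Cn n) p).symm) y) = fun _ => (1 : ℝ) :=
      funext fun y => hs _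
    rw [h3] at h2
    simpa [differential] using h2.symm
  have h2 : sesqMatrix ((ContinuousLinearMap.mul ℝ ℝ).bilinearComp (0 : Cn n →L[ℝ] ℝ)
      (differential η p)) id = 0 := by
    ext i j
    simp [sesqMatrix, sesq]
  simp only [mixedDensity]
  rw [← mixedDet_sum, sesqMatrix_sum_gradForm, h1, h2, mixedDet_zero]

section Chart

variable (K : KahlerStructure n M) (φ : kahlerPotentials K) (ν η f : Smooth n M)

lemma metricMatrix_det_ne_zero {x : Cn n} (hx : x ∈ (chartAt (Cn n) c).target) :
    (metricMatrix K φ c x).det ≠ 0 :=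
  det_chartMatrix_metricTensor_ne_zero K φ ((chartAt (Cn n) c).map_target hx)

lemma contDiffOn_mixedDensity_iddbarMetric :
    ContDiffOn ℝ ∞ (fun x => (jacobian n c ((chartAt (Cn n) c).symm x) : ℂ) *
      mixedDensity K φ ν (iddbarMetric η) ((chartAt (Cn n) c).symm x))
      (chartAt (Cn n) c).target := by
  have h : ContDiffOn ℝ ∞ (fun x => mixedDet (metricMatrix K φ c x)
      (cxHessian (ν ∘ (chartAt (Cn n) c).symm) x) (cxHessian (η ∘ (chartAt (Cn n) c).symm) x))
      (chartAt (Cn n) c).target := fun x hx =>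
    (contDiffAt_mixedDet (contDiffAt_metricMatrix K φ hx)
      (contDiffAt_cxHessian (contDiffAt_chart ν.contMDiff c hx))
      (contDiffAt_cxHessian (contDiffAt_chart η.contMDiff c hx))
      (metricMatrix_det_ne_zero K φ hx)).contDiffWithinAt
  refine h.congr fun x hx => ?_
  rw [jacobian_mul_mixedDensity K _ _ _ hx, chartMatrix_iddbarMetric η.contMDiff
    ((chartAt (Cn n) c).map_target hx), (chartAt (Cn n) c).right_inv hx]

lemma contDiffOn_mixedDensity_gradForm :
    ContDiffOn ℝ ∞ (fun x => (jacobian n c ((chartAt (Cn n) c).symm x) : ℂ) *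
      mixedDensity K φ ν (gradForm f η) ((chartAt (Cn n) c).symm x))
      (chartAt (Cn n) c).target := by
  have h : ContDiffOn ℝ ∞ (fun x => mixedDet (metricMatrix K φ c x)
      (cxHessian (ν ∘ (chartAt (Cn n) c).symm) x) (Matrix.of fun i j =>
        dz i (fun y => ((f ∘ (chartAt (Cn n) c).symm) y : ℂ)) x *
          dzbar j (fun y => ((η ∘ (chartAt (Cn n) c).symm) y : ℂ)) x))
      (chartAt (Cn n) c).target := fun x hx =>
    (contDiffAt_mixedDet (contDiffAt_metricMatrix K φ hx)
      (contDiffAt_cxHessian (contDiffAt_chart ν.contMDiff c hx))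
      (fun i j => (contDiffAt_dz (contDiffAt_ofReal (contDiffAt_chart f.contMDiff c hx)) i).mul
        (contDiffAt_dzbar (contDiffAt_ofReal (contDiffAt_chart η.contMDiff c hx)) j))
      (metricMatrix_det_ne_zero K φ hx)).contDiffWithinAt
  refine h.congr fun x hx => ?_
  rw [jacobian_mul_mixedDensity K _ _ _ hx, chartMatrix_gradForm f.contMDiff η.contMDiff
    ((chartAt (Cn n) c).map_target hx), (chartAt (Cn n) c).right_inv hx]

lemma contDiffOn_comp_chart_symm :
    ContDiffOn ℝ ∞ (fun x => (f ((chartAt (Cn n) c).symm x) : ℂ)) (chartAt (Cn n) c).target :=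
  fun _ hx => (contDiffAt_ofReal (contDiffAt_chart f.contMDiff c hx)).contDiffWithinAt

variable [CompactSpace M]

/-- Integration by parts in a chart: the polarised determinant of `g_φ`, `√-1∂∂̄ν` and `√-1∂∂̄η`
is a divergence. -/
lemma chartIntegral_mul_mixedDensity (hf : tsupport f ⊆ (chartAt (Cn n) c).source) :
    chartIntegral n c (fun p => (f p : ℂ) * mixedDensity K φ ν (iddbarMetric η) p) =
      -chartIntegral n c (mixedDensity K φ ν (gradForm f η)) := by
  set U := (chartAt (Cn n) c).target with hUdef
  have hU : IsOpen U := (chartAt (Cn n) c).open_target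
  set fc : Cn n → ℂ := fun y => ((f ∘ (chartAt (Cn n) c).symm) y : ℂ) with hfc
  set q : Fin n → Cn n → ℂ := fun j => dzbar j fun y => ((η ∘ (chartAt (Cn n) c).symm) y : ℂ)
  set b : Cn n → Matrix (Fin n) (Fin n) ℂ := cxHessian (ν ∘ (chartAt (Cn n) c).symm)
  set X : Fin n → Cn n → ℂ := fun i y =>
    ∑ j, mixedCofactor (metricMatrix K φ c y) (b y) j i * q j y with hX
  have ha : ∀ x ∈ U, ∀ i j, ContDiffAt ℝ ∞ (fun y => metricMatrix K φ c y i j) x := fun x hx =>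
    contDiffAt_metricMatrix K φ hx
  have hb : ∀ x ∈ U, ∀ i j, ContDiffAt ℝ ∞ (fun y => b y i j) x := fun x hx =>
    contDiffAt_cxHessian (contDiffAt_chart ν.contMDiff c hx)
  have hq : ∀ x ∈ U, ∀ j, ContDiffAt ℝ ∞ (q j) x := fun x hx j =>
    contDiffAt_dzbar (contDiffAt_ofReal (contDiffAt_chart η.contMDiff c hx)) j
  have hfd : ∀ x ∈ U, ContDiffAt ℝ ∞ fc x := fun x hx =>
    contDiffAt_ofReal (contDiffAt_chart f.contMDiff c hx)
  have hXd : ∀ x ∈ U, ∀ i, ContDiffAt ℝ ∞ (X i) x := fun x hx i =>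
    ContDiffAt.sum fun j _ => (contDiffAt_mixedCofactor (ha x hx) (hb x hx)
      (metricMatrix_det_ne_zero K φ hx) j i).mul (hq x hx j)
  have one_le : (1 : WithTop ℕ∞) ≤ ∞ := ENat.LEInfty.out
  have key : ∀ x ∈ U, ∑ i, dz i (fun y => fc y * X i y) x =
      (jacobian n c ((chartAt (Cn n) c).symm x) : ℂ) *
        ((f ((chartAt (Cn n) c).symm x) : ℂ) *
          mixedDensity K φ ν (iddbarMetric η) ((chartAt (Cn n) c).symm x)) +
      (jacobian n c ((chartAt (Cn n) c).symm x) : ℂ) *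
        mixedDensity K φ ν (gradForm f η) ((chartAt (Cn n) c).symm x) := by
    intro x hx
    have hc := (chartAt (Cn n) c).map_target hx
    rw [mul_left_comm, jacobian_mul_mixedDensity K _ _ _ hx, jacobian_mul_mixedDensity K _ _ _ hx,
      chartMatrix_iddbarMetric η.contMDiff hc, chartMatrix_gradForm f.contMDiff η.contMDiff hc,
      (chartAt (Cn n) c).right_inv hx]
    have h1 := mixedDet_eq_divergence (fun i j => (ha x hx i j).of_le one_le)
      (fun i j => (hb x hx i j).of_le one_le) (metricMatrix_det_ne_zero K φ hx)
      (dzMatrix_metricMatrix_symm K φ hx)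
      (dzMatrix_cxHessian_symm (contDiffAt_chart ν.contMDiff c hx))
      (fun j => (hq x hx j).of_le one_le)
    have h2 : ∀ i, dz i (fun y => fc y * X i y) x = dz i fc x * X i x + fc x * dz i (X i) x :=
      fun i => dz_mul ((hfd x hx).differentiableAt (by simp))
        ((hXd x hx i).differentiableAt (by simp)) i
    simp only [h2, Finset.sum_add_distrib, ← Finset.mul_sum]
    rw [h1, add_comm]
    congr 1
    rw [mixedDet_eq_trace, Matrix.trace]
    simp only [Matrix.diag, Matrix.mul_apply, Matrix.of_apply, hX, Finset.mul_sum]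
    rw [Finset.sum_comm]
    exact Finset.sum_congr rfl fun j _ => Finset.sum_congr rfl fun i _ => by ring
  have hdiv : ∀ i, IntegrableOn (dz i fun y => fc y * X i y) U ∧
      ∫ x in U, dz i (fun y => fc y * X i y) x = 0 := fun i => by
    refine setIntegral_dz_eq_zero hU (isCompact_chart_image hf) (chart_image_subset hf)
      (fun x hx => ((hfd x hx).mul (hXd x hx i)).of_le one_le) (fun x hx hxf => ?_) i
    have : f ((chartAt (Cn n) c).symm x) = 0 :=
      image_eq_zero_of_notMem_tsupport (notMem_tsupport hx hxf)
    simp [hfc, this]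
  have hsum : ∫ x in U, ∑ i, dz i (fun y => fc y * X i y) x = 0 := by
    rw [integral_finsetSum _ fun i _ => (hdiv i).1]
    exact Finset.sum_eq_zero fun i _ => (hdiv i).2
  rw [setIntegral_congr_fun hU.measurableSet key, integral_add] at hsum
  · exact eq_neg_of_add_eq_zero_left hsum
  · refine integrableOn_chart hf ?_ fun x hx hxf => ?_
    · refine (((contDiffOn_comp_chart_symm f).mul
        (contDiffOn_mixedDensity_iddbarMetric K φ ν η)).continuousOn).congr fun x hx => ?_
      ring
    · rw [image_eq_zero_of_notMem_tsupport hxf]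
      simp
  · refine integrableOn_chart hf (contDiffOn_mixedDensity_gradForm K φ ν η f).continuousOn
      fun x hx hxf => ?_
    rw [mixedDensity_gradForm_eq_zero K _ ν η hxf, mul_zero]

end Chart

end Stokes

section Global

variable {n : ℕ} {M : Type*} [TopologicalSpace M] [ChartedSpace (Cn n) M]
  [IsManifold 𝓘(ℂ, Cn n) ω M] [T2Space M] [CompactSpace M] {c d p : M}

variable (n M) in
/-- The finitely many members of the partition of unity that do not vanish identically. -/
def chartIndex : Finset M :=
  ((chartPartition n M).locallyFinite.finite_nonempty_of_compact).toFinset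

lemma chartPartition_eq_zero (hc : c ∉ chartIndex n M) (p : M) : chartPartition n M c p = 0 := by
  by_contra h
  exact hc ((Set.Finite.mem_toFinset _).2 ⟨p, h⟩)

lemma sum_chartPartition (p : M) : ∑ c ∈ chartIndex n M, chartPartition n M c p = 1 := by
  rw [← (chartPartition n M).sum_eq_one (Set.mem_univ p)]
  refine (finsum_eq_sum_of_support_subset _ fun c hc => ?_).symm
  by_contra h
  exact hc (chartPartition_eq_zero h p)

lemma tsupport_chartPartition (c : M) :
    tsupport (chartPartition n M c) ⊆ (chartAt (Cn n) c).source :=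
  chartPartition_isSubordinate c

omit [T2Space M] [CompactSpace M] in
lemma chartIntegral_sum {ι : Type*} (s : Finset ι) (ψ : ι → M → ℂ)
    (h : ∀ i ∈ s, IntegrableOn (fun x => (jacobian n c ((chartAt (Cn n) c).symm x) : ℂ) *
      ψ i ((chartAt (Cn n) c).symm x)) (chartAt (Cn n) c).target) :
    chartIntegral n c (fun p => ∑ i ∈ s, ψ i p) = ∑ i ∈ s, chartIntegral n c (ψ i) := by
  simp only [chartIntegral, Finset.mul_sum]
  exact integral_finsetSum _ h

/-- The integral over `M` of a density given by `ψ` in the preferred charts. -/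
lemma manifoldIntegral_eq_sum {D : M → M → ℝ} {ψ : M → ℂ}
    (h : ∀ c, ∀ p ∈ (chartAt (Cn n) c).source, (D c p : ℂ) = (jacobian n c p : ℂ) * ψ p) :
    (manifoldIntegral n D : ℂ) = ∑ c ∈ chartIndex n M,
      chartIntegral n c (fun p => (chartPartition n M c p : ℂ) * ψ p) := by
  rw [manifoldIntegral, finsum_eq_sum_of_support_subset (s := chartIndex n M)]
  · push_cast
    refine Finset.sum_congr rfl fun c _ => ?_
    rw [← integral_complex_ofReal]
    refine setIntegral_congr_fun (chartAt (Cn n) c).open_target.measurableSet fun x hx => ?_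
    have := h c _ ((chartAt (Cn n) c).map_target hx)
    push_cast
    rw [this]
    ring
  · intro c hc
    by_contra h'
    refine hc ?_
    simp [chartPartition_eq_zero h']

section Stokes

variable (K : KahlerStructure n M) (φ : kahlerPotentials K) (ν η : Smooth n M)

/-- `∫_M √-1∂∂̄ν ∧ √-1∂∂̄η ∧ ω_φ^{n-2} = 0`: after integration by parts in each chart, the
derivatives fall on the partition of unity, and the sum of those vanishes. -/
lemma sum_chartIntegral_mixedDensity :
    ∑ c ∈ chartIndex n M, chartIntegral n c (fun p =>
      (chartPartition n M c p : ℂ) * mixedDensity K φ ν (iddbarMetric η) p) = 0 := by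
  set ρ := chartPartition n M with hρ
  set s := chartIndex n M
  have hsum : ∀ p, ∑ d ∈ s, (ρ d p : ℂ) = 1 := fun p => by
    exact_mod_cast congrArg (Complex.ofReal) (sum_chartPartition p)
  have hcont : ∀ a c d, ContinuousOn (fun x => (jacobian n a ((chartAt (Cn n) a).symm x) : ℂ) *
      ((ρ d ((chartAt (Cn n) a).symm x) : ℂ) *
        mixedDensity K φ ν (gradForm (ρ c) η) ((chartAt (Cn n) a).symm x)))
      (chartAt (Cn n) a).target := fun a c d => by
    refine ((contDiffOn_comp_chart_symm (ρ d)).mul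
      (contDiffOn_mixedDensity_gradForm K φ ν η (ρ c))).continuousOn.congr fun x hx => ?_
    ring
  calc ∑ c ∈ s, chartIntegral n c (fun p => (ρ c p : ℂ) * mixedDensity K φ ν (iddbarMetric η) p)
      = ∑ c ∈ s, -chartIntegral n c (mixedDensity K φ ν (gradForm (ρ c) η)) :=
        Finset.sum_congr rfl fun c _ =>
          chartIntegral_mul_mixedDensity K φ ν η (ρ c) (tsupport_chartPartition c)
    _ = ∑ c ∈ s, -∑ d ∈ s, chartIntegral n c
          (fun p => (ρ d p : ℂ) * mixedDensity K φ ν (gradForm (ρ c) η) p) := by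
        refine Finset.sum_congr rfl fun c _ => ?_
        rw [← chartIntegral_sum]
        · simp only [← Finset.sum_mul, hsum, one_mul]
        · refine fun d _ => integrableOn_chart (tsupport_chartPartition c) (hcont c c d)
            fun x hx hxc => ?_
          rw [mixedDensity_gradForm_eq_zero K _ ν η hxc, mul_zero, mul_zero]
    _ = ∑ c ∈ s, -∑ d ∈ s, chartIntegral n d
          (fun p => (ρ d p : ℂ) * mixedDensity K φ ν (gradForm (ρ c) η) p) := by
        refine Finset.sum_congr rfl fun c _ => congrArg _ (Finset.sum_congr rfl fun d _ => ?_)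
        refine chartIntegral_eq _ fun p hp => ⟨?_, ?_⟩
        · by_contra h
          exact hp (by rw [mixedDensity_gradForm_eq_zero K _ ν η
            fun h' => h (tsupport_chartPartition c h'), mul_zero])
        · by_contra h
          exact hp (by rw [image_eq_zero_of_notMem_tsupport
            fun h' => h (tsupport_chartPartition d h'), Complex.ofReal_zero, zero_mul])
    _ = -∑ d ∈ s, chartIntegral n d
          (fun p => ∑ c ∈ s, (ρ d p : ℂ) * mixedDensity K φ ν (gradForm (ρ c) η) p) := by
        rw [Finset.sum_neg_distrib, Finset.sum_comm]
        refine congrArg _ (Finset.sum_congr rfl fun d _ => ?_)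
        rw [chartIntegral_sum]
        refine fun c _ => integrableOn_chart (tsupport_chartPartition d) (hcont d c d)
          fun x hx hxd => ?_
        rw [image_eq_zero_of_notMem_tsupport hxd, Complex.ofReal_zero, zero_mul, mul_zero]
    _ = 0 := by
        rw [neg_eq_zero]
        refine Finset.sum_eq_zero fun d _ => ?_
        simp only [← Finset.mul_sum,
          sum_mixedDensity_gradForm s K φ ν η ρ fun p => sum_chartPartition p, mul_zero,
          chartIntegral, integral_zero]

end Stokes

end Global

/-! ### Traces and volume densities -/

section Densities

variable {n : ℕ} {M : Type*} [TopologicalSpace M] [ChartedSpace (Cn n) M]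
  [IsManifold 𝓘(ℂ, Cn n) ω M] {c p : M}

lemma iddbarMetric_invariant {f : M → ℝ} (hf : ContMDiff 𝓘(ℝ, Cn n) 𝓘(ℝ) ∞ f) (p : M)
    (u v : Tan n p) : iddbarMetric f p (cxJ n p u) (cxJ n p v) = iddbarMetric f p u v := by
  have h : ∀ u v : Tan n p, iddbarMetric f p u v = _ := fun u v => iddbar_cxJ hf p u v
  have hJ : ∀ u : Tan n p, mulI n (cxJ n p u) = -u := fun u => mulI_mulI u
  rw [h, h, hJ, hJ]
  have h2 : ∀ (H : Cn n →L[ℝ] Cn n →L[ℝ] ℝ) (a b : Cn n),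
      (H (-a) (-b) + H (mulI n a) (mulI n b)) / 2 = (H (mulI n a) (mulI n b) + H a b) / 2 := by
    intro H a b
    simp only [map_neg, neg_apply, neg_neg]
    ring
  exact h2 _ u v

lemma metricTensor_invariant (K : KahlerStructure n M) (φ : Smooth n M) (p : M) (u v : Tan n p) :
    metricTensor K φ p (cxJ n p u) (cxJ n p v) = metricTensor K φ p u v := by
  rw [metricTensor_eq]
  change K.metric.inner p (cxJ n p u) (cxJ n p v) +
    iddbarMetric φ p (cxJ n p u) (cxJ n p v) = K.metric.inner p u v + iddbarMetric φ p u v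
  rw [K.hermitian, iddbarMetric_invariant φ.contMDiff]

lemma realMatrix_eq {h : Tan n p →L[ℝ] Tan n p →L[ℝ] ℝ}
    (hJ : ∀ u v, h (cxJ n p u) (cxJ n p v) = h u v) (hc : p ∈ (chartAt (Cn n) c).source) :
    realMatrix h c = (2 : ℝ) • realify (chartMatrix h c) := by
  have h1 : ∀ i j, chartMatrix h c i j = (1 / 2) *
      ((h (coordVec n c p (Pi.single i 1)) (coordVec n c p (Pi.single j 1)) : ℂ) + Complex.I *
        (h (coordVec n c p (Pi.single i 1)) (cxJ n p (coordVec n c p (Pi.single j 1))) : ℂ)) :=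
    fun i j => sesq_of_invariant (h := modelForm h) hJ _ _
  have h2 : ∀ i : Fin n, coordVec n c p (Pi.single i Complex.I) =
      cxJ n p (coordVec n c p (Pi.single i 1)) := fun i => by
    rw [← mulI_single, coordVec_mulI hc]
  have h3 : ∀ u v, h (cxJ n p u) v = -h u (cxJ n p v) := invariant_left (h := modelForm h) hJ
  have h4 : ∀ u v : Tan n p, h u (cxJ n p (cxJ n p v)) = -h u v := fun u v =>
    (congrArg (h u) (mulI_mulI v)).trans (map_neg (h u) v)
  ext i j
  rcases i with i | i <;> rcases j with j | j <;>
    simp [realMatrix, realBasis, realify, h1, h2, h3, h4]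

variable (K : KahlerStructure n M) (φ : kahlerPotentials K) (ν η : Smooth n M)

lemma toMetric_inner (p : M) : (toMetric K φ).inner p = metricTensor K φ p := rfl

lemma dToMetric_toFun (p : M) : (dToMetric K φ ν).toFun p = iddbarMetric ν p :=
  deriv_metricTensor K φ ν p

lemma mixedDensity_iddbarMetric (p : M) : mixedDensity K φ ν (iddbarMetric η) p =
    mixedDet (metricAt K φ p) (hessianAt ν p) (hessianAt η p) := rfl

lemma isHermitian_metricAt (p : M) : (metricAt K φ p).IsHermitian :=
  isHermitian_sesqMatrix (metricTensor_symm K φ p) _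

lemma isHermitian_hessianAt (p : M) : (hessianAt ν p).IsHermitian :=
  isHermitian_sesqMatrix (fun u v => iddbar_cxJ_symm ν.contMDiff p u v) _

lemma ofReal_re_trace {A : Matrix (Fin n) (Fin n) ℂ} (h : A.conjTranspose.trace = A.trace) :
    (A.trace.re : ℂ) = A.trace := by
  rw [Matrix.trace_conjTranspose] at h
  exact Complex.conj_eq_iff_re.1 h

lemma ofReal_re_det {A : Matrix (Fin n) (Fin n) ℂ} (h : A.IsHermitian) :
    (A.det.re : ℂ) = A.det := by
  have h1 := Matrix.det_conjTranspose A
  rw [h.eq] at h1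
  exact Complex.conj_eq_iff_re.1 h1.symm

lemma laplacian_eq (p : M) :
    (laplacian K φ ν p : ℂ) = ((metricAt K φ p)⁻¹ * hessianAt ν p).trace := by
  have hp := mem_chart_source (Cn n) p
  have h1 : laplacian K φ ν p = ((metricAt K φ p)⁻¹ * hessianAt ν p).trace.re := by
    rw [laplacian, hermMatrix_eq, ← chartMatrix_iddbarMetric ν.contMDiff hp, chartMatrix_eq,
      chartMatrix_eq, trace_congr (frameMatrix_det_ne_zero hp)]
    rfl
  rw [h1]
  refine ofReal_re_trace ?_
  rw [Matrix.conjTranspose_mul, Matrix.conjTranspose_nonsing_inv, (isHermitian_metricAt K φ p).eq,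
    (isHermitian_hessianAt ν p).eq, Matrix.trace_mul_comm]

lemma traceProduct_eq (p : M) :
    (traceProduct (toMetric K φ) (dToMetric K φ ν) (dToMetric K φ η) p : ℂ) =
      2 * ((metricAt K φ p)⁻¹ * hessianAt ν p * (metricAt K φ p)⁻¹ * hessianAt η p).trace := by
  have hp := mem_chart_source (Cn n) p
  have h0 := det_chartMatrix_metricTensor_ne_zero K φ hp
  have hinv : ((2 : ℝ) • realify (chartMatrix (metricTensor K φ p) p))⁻¹ =
      (1 / 2 : ℝ) • realify (chartMatrix (metricTensor K φ p) p)⁻¹ := by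
    refine Matrix.inv_eq_left_inv ?_
    rw [Matrix.smul_mul, Matrix.mul_smul, smul_smul, ← realify_mul,
      Matrix.nonsing_inv_mul _ (isUnit_iff_ne_zero.2 h0), realify_one]
    norm_num
  have h1 : traceProduct (toMetric K φ) (dToMetric K φ ν) (dToMetric K φ η) p =
      2 * ((metricAt K φ p)⁻¹ * hessianAt ν p * (metricAt K φ p)⁻¹ * hessianAt η p).trace.re := by
    rw [traceProduct, toMetric_inner, dToMetric_toFun, dToMetric_toFun,
      realMatrix_eq (metricTensor_invariant K φ p) hp,
      realMatrix_eq (iddbarMetric_invariant ν.contMDiff p) hp,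
      realMatrix_eq (iddbarMetric_invariant η.contMDiff p) hp, hinv]
    simp only [Matrix.smul_mul, Matrix.mul_smul, smul_smul, ← realify_mul]
    rw [Matrix.trace_smul, trace_realify, chartMatrix_eq, chartMatrix_eq, chartMatrix_eq,
      trace_congr_mul (frameMatrix_det_ne_zero hp)]
    norm_num
    rfl
  rw [h1, Complex.ofReal_mul, ofReal_re_trace, Complex.ofReal_ofNat]
  simp only [Matrix.conjTranspose_mul, Matrix.conjTranspose_nonsing_inv,
    (isHermitian_metricAt K φ p).eq, (isHermitian_hessianAt _ p).eq]
  rw [Matrix.trace_mul_comm]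
  simp only [Matrix.mul_assoc]

lemma volumeDensity_eq (hc : p ∈ (chartAt (Cn n) c).source) :
    (volumeDensity (toMetric K φ) c p : ℂ) = jacobian n c p * (2 ^ n * (metricAt K φ p).det) := by
  have hdet := ofReal_re_det (isHermitian_metricAt K φ p)
  have h1 : volumeDensity (toMetric K φ) c p =
      jacobian n c p * (2 ^ n * (metricAt K φ p).det.re) := by
    rw [volumeDensity, toMetric_inner, realMatrix_eq (metricTensor_invariant K φ p) hc,
      Matrix.det_smul, det_realify, chartMatrix_eq, det_congr, ← jacobian_eq_normSq hc]
    have h2 : (metricAt K φ p).det = ((metricAt K φ p).det.re : ℂ) := hdet.symm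
    change √(_ * Complex.normSq (_ * (metricAt K φ p).det)) = _
    rw [h2, ← Complex.ofReal_mul, Complex.normSq_ofReal, Complex.ofReal_re]
    have h3 : (2 : ℝ) ^ Fintype.card (Fin n ⊕ Fin n) = 2 ^ n * 2 ^ n := by
      rw [Fintype.card_sum, Fintype.card_fin, pow_add]
    rw [h3, ← Real.sqrt_mul_self (mul_pos (jacobian_pos hc)
      (mul_pos (pow_pos two_pos n) (det_metricAt_pos K φ p))).le]
    congr 1
    ring
  rw [h1, ← hdet]
  push_cast
  rfl

lemma volumeForm_eq :
    (volumeForm K φ c p : ℂ) = jacobian n c p * (2 ^ n * (metricAt K φ p).det) := by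
  have hdet := ofReal_re_det (isHermitian_metricAt K φ p)
  have hg : ∀ u v, modelForm (metricTensor K φ p) (mulI n u) (mulI n v) =
      modelForm (metricTensor K φ p) u v := metricTensor_invariant K φ p
  have hω : ∀ u v : Cn n, modelForm (kahlerForm K φ p) u v =
      -2 * (∑ i, ∑ j, metricAt K φ p i j * (u i * conj (v j))).im := fun u v => by
    have h1 : (∑ i, ∑ j, metricAt K φ p i j * (u i * conj (v j))) =
        sesq (modelForm (metricTensor K φ p)) u v := (sesq_expand_basis _ _ _).symm
    have h2 : modelForm (metricTensor K φ p) u (mulI n v) = -modelForm (kahlerForm K φ p) u v := by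
      change modelForm (kahlerForm K φ p) u (mulI n (mulI n v)) = _
      rw [mulI_mulI, map_neg]
    rw [h1, sesq_of_invariant hg, h2]
    simp
  let β : Cn n →ₗ[ℝ] Cn n →ₗ[ℝ] ℝ := LinearMap.mk₂ ℝ (fun u v => modelForm (kahlerForm K φ p) u v)
    (fun u u' v => by simp) (fun c u v => by simp) (fun u v v' => by simp) (fun c u v => by simp)
  have h3 := wedgePow_comp β (transition n c p : Cn n →ₗ[ℝ] Cn n)
  have h4 : wedgePow (fun x y => β x y) n (orientedBasis n) =
      2 ^ n * n.factorial * (metricAt K φ p).det.re := by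
    rw [← wedgePow_posDef (posDef_metricAt K φ p)]
    congr 1
    funext u v
    exact hω u v
  have h5 : volumeForm K φ c p =
      wedgePow (fun x y => β (transition n c p x) (transition n c p y)) n (orientedBasis n) /
        n.factorial := rfl
  have h6 : volumeForm K φ c p = jacobian n c p * (2 ^ n * (metricAt K φ p).det.re) := by
    rw [h5]
    refine (congrArg (· / (n.factorial : ℝ)) h3).trans ?_
    have hn : (n.factorial : ℝ) ≠ 0 := by exact_mod_cast n.factorial_ne_zero
    simp only [h4]
    rw [show LinearMap.det (transition n c p : Cn n →ₗ[ℝ] Cn n) = jacobian n c p from rfl]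
    field_simp
  rw [h6, ← hdet]
  push_cast
  rfl

end Densities

/-! ### Comparison of the Ebin and Calabi metrics -/

section Comparison

variable {n : ℕ} {M : Type*} [TopologicalSpace M] [ChartedSpace (Cn n) M]
  [IsManifold 𝓘(ℂ, Cn n) ω M] [T2Space M] [CompactSpace M]
  (K : KahlerStructure n M) (φ : kahlerPotentials K) (ν η : Smooth n M)

/-- The integrand of the Calabi metric, divided by `2ⁿ`, in the preferred chart at `p`. -/
def calabiDensity (p : M) : ℂ :=
  (metricAt K φ p).det * (((metricAt K φ p)⁻¹ * hessianAt ν p).trace *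
    ((metricAt K φ p)⁻¹ * hessianAt η p).trace)

/-- The integrand of the Ebin metric, divided by `2ⁿ⁺¹`, in the preferred chart at `p`. -/
def ebinDensity (p : M) : ℂ :=
  (metricAt K φ p).det *
    ((metricAt K φ p)⁻¹ * hessianAt ν p * (metricAt K φ p)⁻¹ * hessianAt η p).trace

lemma integrableOn_calabiDensity (c : M) :
    IntegrableOn (fun x => (jacobian n c ((chartAt (Cn n) c).symm x) : ℂ) *
      ((chartPartition n M c ((chartAt (Cn n) c).symm x) : ℂ) *
        calabiDensity K φ ν η ((chartAt (Cn n) c).symm x))) (chartAt (Cn n) c).target := by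
  refine integrableOn_chart (tsupport_chartPartition c) (ContDiffOn.continuousOn (𝕜 := ℝ) (n := ∞)
    ?_) fun x hx hxc => ?_
  · have h : ContDiffOn ℝ ∞ (fun x => (metricMatrix K φ c x).det *
        (((metricMatrix K φ c x)⁻¹ * cxHessian (ν ∘ (chartAt (Cn n) c).symm) x).trace *
          ((metricMatrix K φ c x)⁻¹ * cxHessian (η ∘ (chartAt (Cn n) c).symm) x).trace))
        (chartAt (Cn n) c).target := fun x hx => by
      have ha := contDiffAt_metricMatrix K φ hx
      have hW := contDiffAt_inv ha (metricMatrix_det_ne_zero K φ hx)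
      exact ((contDiffAt_det ha).mul
        ((contDiffAt_trace (contDiffAt_mul hW
          (contDiffAt_cxHessian (contDiffAt_chart ν.contMDiff c hx)))).mul
        (contDiffAt_trace (contDiffAt_mul hW
          (contDiffAt_cxHessian (contDiffAt_chart η.contMDiff c hx)))))).contDiffWithinAt
    refine ((contDiffOn_comp_chart_symm (chartPartition n M c)).mul h).congr fun x hx => ?_
    have hc := (chartAt (Cn n) c).map_target hx
    have hH : ∀ f : Smooth n M, cxHessian (f ∘ (chartAt (Cn n) c).symm) x =
        chartMatrix (iddbarMetric f ((chartAt (Cn n) c).symm x)) c := fun f => by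
      rw [chartMatrix_iddbarMetric f.contMDiff hc, (chartAt (Cn n) c).right_inv hx]
    have hL := frameMatrix_det_ne_zero hc
    rw [hH, hH, metricMatrix, chartMatrix_eq, chartMatrix_eq, chartMatrix_eq, trace_congr hL,
      trace_congr hL, det_congr, ← jacobian_eq_normSq hc]
    simp only [calabiDensity, metricAt, hessianAt]
    ring
  · rw [image_eq_zero_of_notMem_tsupport hxc, Complex.ofReal_zero, zero_mul, mul_zero]

/-- The pull-back of the Ebin metric is twice the Calabi metric. -/
lemma ebinMetric_eq_two_mul_calabiMetric :
    ebinMetric (toMetric K φ) (dToMetric K φ ν) (dToMetric K φ η) =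
      2 * calabiMetric K φ ν η := by
  have h1 : (ebinMetric (toMetric K φ) (dToMetric K φ ν) (dToMetric K φ η) : ℂ) =
      ∑ c ∈ chartIndex n M, chartIntegral n c (fun p => (chartPartition n M c p : ℂ) *
        (2 * 2 ^ n * ebinDensity K φ ν η p)) :=
    manifoldIntegral_eq_sum fun c p hc => by
      push_cast
      rw [traceProduct_eq, volumeDensity_eq K φ hc, ebinDensity]
      ring
  have h2 : (calabiMetric K φ ν η : ℂ) =
      ∑ c ∈ chartIndex n M, chartIntegral n c (fun p => (chartPartition n M c p : ℂ) *
        (2 ^ n * calabiDensity K φ ν η p)) :=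
    manifoldIntegral_eq_sum fun c p hc => by
      push_cast
      rw [laplacian_eq, laplacian_eq, volumeForm_eq K φ, calabiDensity]
      ring
  have hmul : ∀ (a : ℂ) (ψ : M → ℂ) (c : M),
      chartIntegral n c (fun p => (chartPartition n M c p : ℂ) * (a * ψ p)) =
        a * chartIntegral n c (fun p => (chartPartition n M c p : ℂ) * ψ p) := fun a ψ c => by
    rw [chartIntegral, chartIntegral, ← integral_const_mul]
    congr 1
    funext x
    ring
  simp only [hmul, ← Finset.mul_sum] at h1 h2
  have h3 : ∀ c, chartIntegral n c
        (fun p => (chartPartition n M c p : ℂ) * ebinDensity K φ ν η p) =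
      chartIntegral n c (fun p => (chartPartition n M c p : ℂ) * calabiDensity K φ ν η p) -
        chartIntegral n c (fun p => (chartPartition n M c p : ℂ) *
          mixedDensity K φ ν (iddbarMetric η) p) := fun c => by
    rw [chartIntegral, chartIntegral, chartIntegral, ← integral_sub]
    · congr 1
      funext x
      rw [mixedDensity_iddbarMetric, mixedDet, calabiDensity, ebinDensity]
      ring
    · exact integrableOn_calabiDensity K φ ν η c
    · refine integrableOn_chart (tsupport_chartPartition c) ?_ fun x hx hxc => ?_
      · refine (((contDiffOn_comp_chart_symm (chartPartition n M c)).mul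
          (contDiffOn_mixedDensity_iddbarMetric K φ ν η)).continuousOn).congr fun x hx => ?_
        ring
      · rw [image_eq_zero_of_notMem_tsupport hxc, Complex.ofReal_zero, zero_mul, mul_zero]
  simp only [h3, Finset.sum_sub_distrib, sum_chartIntegral_mixedDensity, sub_zero] at h1
  have h4 : (ebinMetric (toMetric K φ) (dToMetric K φ ν) (dToMetric K φ η) : ℂ) =
      ((2 * calabiMetric K φ ν η : ℝ) : ℂ) := by
    rw [h1]
    push_cast
    rw [h2]
    ring
  exact_mod_cast h4

/-- The Calabi metric depends only on `g_φ` and the tangent vectors `dg_φ(ν)`, `dg_φ(η)`, since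
twice its value is the Ebin metric of those. -/
lemma calabiOnMetrics_eq :
    calabiOnMetrics K (toMetric K φ) (dToMetric K φ ν) (dToMetric K φ η) =
      calabiMetric K φ ν η := by
  have H : ∃ d : kahlerPotentials K × Smooth n M × Smooth n M, toMetric K d.1 = toMetric K φ ∧
      dToMetric K d.1 d.2.1 = dToMetric K φ ν ∧ dToMetric K d.1 d.2.2 = dToMetric K φ η :=
    ⟨(φ, ν, η), rfl, rfl, rfl⟩
  rw [calabiOnMetrics, dif_pos H]
  obtain ⟨e1, e2, e3⟩ := H.choose_spec
  have h1 := ebinMetric_eq_two_mul_calabiMetric K H.choose.1 H.choose.2.1 H.choose.2.2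
  rw [e1, e2, e3, ebinMetric_eq_two_mul_calabiMetric K φ ν η] at h1
  linarith

omit [T2Space M] [CompactSpace M] in
lemma dToMetric_eq (ψ : kahlerPotentials K) : dToMetric K ψ ν = dToMetric K φ ν :=
  SymTensor.ext (funext fun p => (dToMetric_toFun K ψ ν p).trans (dToMetric_toFun K φ ν p).symm)

end Comparison

end

end Kahler

theorem proposition2p1 (n : ℕ) {M : Type*} [TopologicalSpace M] [T2Space M] [CompactSpace M]
    [ChartedSpace (Kahler.Cn n) M] [IsManifold 𝓘(ℂ, Kahler.Cn n) ω M]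
    (K : Kahler.KahlerStructure n M) :
    (∀ (φ : Kahler.kahlerPotentials K) (ν η : Kahler.Smooth n M),
      Kahler.ebinMetric (Kahler.toMetric K φ) (Kahler.dToMetric K φ ν) (Kahler.dToMetric K φ η) =
        2 * Kahler.calabiMetric K φ ν η) ∧
    (∀ (φ : Kahler.kahlerPotentials K) (ν η : Kahler.Smooth n M),
      Kahler.calabiOnMetrics K (Kahler.toMetric K φ) (Kahler.dToMetric K φ ν)
        (Kahler.dToMetric K φ η) = Kahler.calabiMetric K φ ν η) ∧
    (∀ g ∈ Kahler.kahlerMetrics K,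
      ∀ h ∈ Kahler.kahlerTangent K g, ∀ k ∈ Kahler.kahlerTangent K g,
        Kahler.ebinMetric g h k = 2 * Kahler.calabiOnMetrics K g h k) := by
  refine ⟨Kahler.ebinMetric_eq_two_mul_calabiMetric K, Kahler.calabiOnMetrics_eq K, ?_⟩
  rintro g - h ⟨φ, ν, rfl, rfl⟩ k ⟨ψ, η, -, rfl⟩
  rw [Kahler.dToMetric_eq K φ η ψ, Kahler.ebinMetric_eq_two_mul_calabiMetric,
    Kahler.calabiOnMetrics_eq]
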